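/- Let $E$ be a complex Banach space with a Schauder basis $(e_i)_{i\in\mathbb N}$; write $x=(x_0,x_1,\dots)$ for the coordinates of $x\in E$ and assume that for every $x\in E$ there is $i_0\in\mathbb N$ with $\sup_{i\in\mathbb N}|x_i|=|x_{i_0}|$. Let $L$ be a (possibly unbounded) linear operator on $E$, with domain a linear subspace $D(L)\subset E$, given by an infinite complex matrix $(l_{ij})_{(i,j)\in\mathbb N^2}$ with respect to the basis, i.e. $(Lx)_i=\sum_{j=0}^{\infty} l_{ij}x_j$ (a convergent series) for all $x\in D(L)$ and $i\in\mathbb N$. Assume that $L$ has compact resolvent, i.e. for some $z\in\mathbb C$ the map $L-z:D(L)\to E$ is bijective with a bounded inverse that is compact as an operator on $E$. For $i\in\mathbb N$ let $$r_i(L)=\sum_{j\in\mathbb N\setminus\{i\}}|l_{ij}|\in[0,\infty],\qquad \mathcal D_i(L)=\{z\in\mathbb C:\ |z-l_{ii}|\le r_i(L)\}$$ (so that $\mathcal D_i(L)=\mathbb C$ if $r_i(L)=\infty$). Then the spectrum of $L$ satisfies $$\sigma(L)\subset\bigcup_{i\in\mathbb N}\mathcal D_i(L).$$ Furthermore, if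 $K\in\mathbb N$ and $i_1,\dots,i_K\in\mathbb N$ are distinct indices such that $\mathcal R=\bigcup_{k=1}^K\mathcal D_{i_k}(L)$ is disjoint from $\bigcup_{i\in\mathbb N\setminus\{i_1,\dots,i_K\}}\mathcal D_i(L)$, then $\mathcal R$ contains exactly $K$ eigenvalues of $L$ counted with algebraic multiplicity: $\mathcal R$ contains only finitely many eigenvalues $\lambda$ of $L$, each has finite algebraic multiplicity $\dim\bigcup_{n\ge 0}\ker (L-\lambda)^n$, and these multiplicities add up to $K$. -/

import Mathlib

open scoped ENNReal

namespace InfiniteGershgorin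

/-! ### Spectral notions for a possibly unbounded operator

A possibly unbounded linear operator on `E` is a linear map `L : E →ₗ.[ℂ] E` from a linear subspace
`L.domain` of `E` to `E`. -/

section Operator

variable {E : Type*} [NormedAddCommGroup E] [NormedSpace ℂ E]

/-- The bounded operator `T` on `E` is the inverse of `L - z : L.domain → E`. -/
structure IsResolventAt (L : E →ₗ.[ℂ] E) (z : ℂ) (T : E →L[ℂ] E) : Prop where
  mem_domain : ∀ y : E, T y ∈ L.domain
  right_inv : ∀ y : E, L ⟨T y, mem_domain y⟩ - z • T y = y
  left_inv : ∀ x : L.domain, T (L x - z • (x : E)) = x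

/-- The resolvent set: all `z` for which `L - z` is a bijection from the domain of `L` onto `E` with
bounded inverse. -/
def resolventSet (L : E →ₗ.[ℂ] E) : Set ℂ :=
  {z | ∃ T : E →L[ℂ] E, IsResolventAt L z T}

/-- The spectrum, i.e. the complement of the resolvent set. -/
def spectrum (L : E →ₗ.[ℂ] E) : Set ℂ :=
  (resolventSet L)ᶜ

/-- `L` has compact resolvent: `(L - z)⁻¹` exists as a bounded operator and is compact, for some `z`
(equivalently, by the resolvent identity, the resolvent set is nonempty and this holds for all
its points `z`). -/
def HasCompactResolvent (L : E →ₗ.[ℂ] E) : Prop :=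
  ∃ (z : ℂ) (T : E →L[ℂ] E), IsResolventAt L z T ∧ IsCompactOperator T

/-- The set of eigenvalues of `L`. -/
def eigenvalues (L : E →ₗ.[ℂ] E) : Set ℂ :=
  {z | ∃ x : L.domain, (x : E) ≠ 0 ∧ L x = z • (x : E)}

/-- The kernel of `(L - z) ^ n`, with its natural domain. -/
def powKer (L : E →ₗ.[ℂ] E) (z : ℂ) : ℕ → Submodule ℂ E
  | 0 => ⊥
  | n + 1 => ((powKer L z n).comap (L.toFun - z • L.domain.subtype)).map L.domain.subtype

/-- The generalized eigenspace (root space) of `L` at `z`: the union over `n` of the kernels of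
`(L - z) ^ n`. -/
def rootSpace (L : E →ₗ.[ℂ] E) (z : ℂ) : Submodule ℂ E :=
  ⨆ n, powKer L z n

/-- `A` contains exactly `K` eigenvalues of `L` counted with algebraic multiplicity: it contains only
finitely many eigenvalues, their root spaces are finite-dimensional, and the dimensions of these
root spaces add up to `K`. -/
def ContainsExactly (L : E →ₗ.[ℂ] E) (A : Set ℂ) (K : ℕ) : Prop :=
  ∃ h : (A ∩ eigenvalues L).Finite,
    (∀ z ∈ h.toFinset, FiniteDimensional ℂ (rootSpace L z)) ∧
      ∑ z ∈ h.toFinset, Module.finrank ℂ (rootSpace L z) = K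

theorem mem_powKer_succ (L : E →ₗ.[ℂ] E) (z : ℂ) (n : ℕ) (x : E) :
    x ∈ powKer L z (n + 1) ↔ ∃ h : x ∈ L.domain, L ⟨x, h⟩ - z • x ∈ powKer L z n := by
  simp only [powKer, Submodule.mem_map, Submodule.mem_comap]
  constructor
  · rintro ⟨y, hy, rfl⟩
    exact ⟨y.2, hy⟩
  · rintro ⟨h, hx⟩
    exact ⟨⟨x, h⟩, hx, rfl⟩

end Operator

/-! ### Infinite matrices and their Gershgorin disks -/

/-- `L` is the operator of the infinite matrix `l` with respect to the Schauder basis `b`: for `x` in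
the domain of `L`, the `i`-th coordinate of `L x` is the (convergent) series
`∑ j, l i j * x j`. -/
def IsMatrixOf {E : Type*} [NormedAddCommGroup E] [NormedSpace ℂ E] (b : SchauderBasis ℂ E)
    (L : E →ₗ.[ℂ] E) (l : ℕ → ℕ → ℂ) : Prop :=
  ∀ (x : L.domain) (i : ℕ),
    HasSum (fun j => l i j * b.coord j (x : E)) (b.coord i (L x)) (SummationFilter.conditional ℕ)

/-- If `b j` is in the domain of `L`, the `j`-th column of the matrix of `L` consists of the
coordinates of `L (b j)`. -/
theorem IsMatrixOf.entry_eq {E : Type*} [NormedAddCommGroup E] [NormedSpace ℂ E]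
    {b : SchauderBasis ℂ E} {L : E →ₗ.[ℂ] E} {l : ℕ → ℕ → ℂ} (h : IsMatrixOf b L l) (j : ℕ)
    (hj : b j ∈ L.domain) (i : ℕ) : l i j = b.coord i (L ⟨b j, hj⟩) := by
  have h1 := h ⟨b j, hj⟩ i
  have h2 : HasSum (fun k => l i k * b.coord k (b j)) (l i j)
      (SummationFilter.conditional ℕ) := by
    have h3 : HasSum (fun k => l i k * b.coord k (b j)) (l i j * b.coord j (b j)) := by
      refine hasSum_single j fun k hk => ?_
      simp [b.ortho, hk]
    simp only [b.ortho j j, Pi.single_apply, if_true, mul_one] at h3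
    exact h3.mono_left (SummationFilter.conditional ℕ).le_atTop
  exact h2.unique h1

/-- The radius of the `i`-th Gershgorin disk, possibly infinite: the sum of `|l i j|` over `j ≠ i`. -/
noncomputable def radius (l : ℕ → ℕ → ℂ) (i : ℕ) : ℝ≥0∞ :=
  ∑' j : {j : ℕ // j ≠ i}, ‖l i j‖ₑ

/-- The `i`-th (closed) Gershgorin disk; it is all of `ℂ` if the radius is infinite. -/
def disk (l : ℕ → ℕ → ℂ) (i : ℕ) : Set ℂ :=
  {z | ‖z - l i i‖ₑ ≤ radius l i}

end InfiniteGershgorin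

/-! Inclusion: with a compact resolvent, the Fredholm alternative makes every spectral point an
eigenvalue. In the row of a coordinate of maximal modulus of an eigenvector, the eigenvalue equation
places the eigenvalue in that row's disk.

Counting: let `A` be the off-diagonal part of the rows in `S`, and deform `L` into `L - t A`, `0 ≤ t
≤ 1`. Damping only shrinks the off-diagonal part of a row, so eigenvalues stay in the original
disks. Infinitely many other disks may accumulate at the region `R` of the disks in `S`, but
eigenvalues cannot: compactness of the resolvent gives an open `U ⊇ R` such that no `L - t A` has an
eigenvalue in `U \ R` (`exists_isolating_nhds`). For a fixed `z ∈ U \ R` the resolvents at `z` form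
a norm-continuous path of compact operators, and `w ↦ (w - z)⁻¹` carries root spaces of `L` to
generalized eigenspaces of its resolvent (`rootSpace_eq`).

The dimension of the spectral subspace for the image of `R` is locally constant along the path. No
contour integral is used: the spectral projection comes from Riesz theory, and it is deformed by
solving a Riccati equation with the implicit function theorem (`exists_deformation`). At `t = 1` the
rows in `S` are diagonal, and reading off the coordinates in `S` identifies the spectral subspace
with `ℂ^S` (`finrank_range_eq_card`). -/

namespace InfiniteGershgorin

/-! ### Riesz theory: spectral projections of compact operators -/

section Riesz

variable {E : Type*} [NormedAddCommGroup E] [NormedSpace ℂ E]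

/-- The product of the operators `T - μ` over the entries `μ` of a list. -/
def shiftProd (T : E →L[ℂ] E) (l : List ℂ) : E →L[ℂ] E :=
  (l.map fun μ => T - μ • 1).prod

@[simp] theorem shiftProd_nil (T : E →L[ℂ] E) : shiftProd T [] = 1 := rfl

@[simp] theorem shiftProd_cons (T : E →L[ℂ] E) (μ : ℂ) (l : List ℂ) :
    shiftProd T (μ :: l) = (T - μ • 1) * shiftProd T l := by
  simp [shiftProd]

theorem commute_shift {S T : E →L[ℂ] E} (h : Commute S T) (μ : ℂ) : Commute S (T - μ • 1) :=
  h.sub_right ((Commute.one_right S).smul_right μ)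

theorem commute_shiftProd {S T : E →L[ℂ] E} (h : Commute S T) (l : List ℂ) :
    Commute S (shiftProd T l) := by
  induction l with
  | nil => exact Commute.one_right S
  | cons μ l ih => rw [shiftProd_cons]; exact (commute_shift h μ).mul_right ih

theorem shift_shiftProd_apply (T : E →L[ℂ] E) (l : List ℂ) (μ : ℂ) (x : E) :
    shiftProd T l ((T - μ • 1) x) = (T - μ • 1) (shiftProd T l x) := by
  have h : Commute (T - μ • 1) (shiftProd T l) :=
    commute_shiftProd (commute_shift (Commute.refl T) μ).symm l
  exact (DFunLike.congr_fun h.eq x).symm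

theorem isCompactOperator_mul_left {K : E →L[ℂ] E} (hK : IsCompactOperator K) (A : E →L[ℂ] E) :
    IsCompactOperator (A * K : E →L[ℂ] E) := by
  rw [ContinuousLinearMap.mul_def, ContinuousLinearMap.coe_comp]
  exact hK.clm_comp A

theorem isCompactOperator_mul_right {K : E →L[ℂ] E} (hK : IsCompactOperator K) (A : E →L[ℂ] E) :
    IsCompactOperator (K * A : E →L[ℂ] E) := by
  rw [ContinuousLinearMap.mul_def, ContinuousLinearMap.coe_comp]
  exact hK.comp_clm A

/-- The products of shifts of a compact operator by nonzero numbers are compact perturbations of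
nonzero multiples of the identity. -/
theorem shiftProd_eq_smul_add_compact {T : E →L[ℂ] E} (hT : IsCompactOperator T) (l : List ℂ)
    (hl : ∀ μ ∈ l, μ ≠ 0) :
    ∃ c : ℂ, c ≠ 0 ∧ ∃ K : E →L[ℂ] E, IsCompactOperator K ∧ shiftProd T l = c • 1 + K := by
  induction l with
  | nil => exact ⟨1, one_ne_zero, 0, isCompactOperator_zero, by simp⟩
  | cons μ l ih =>
    obtain ⟨c, hc, K, hK, h⟩ := ih fun ν hν => hl ν (List.mem_cons_of_mem _ hν)
    refine ⟨-μ * c, mul_ne_zero (neg_ne_zero.2 (hl μ List.mem_cons_self)) hc,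
      c • T + (T - μ • 1) * K, ?_, ?_⟩
    · exact (hT.smul c).add (isCompactOperator_mul_left hK (T - μ • 1))
    · rw [shiftProd_cons, h]
      ext x
      simp
      module

/-- An injective compact perturbation of a nonzero multiple of the identity is invertible. -/
theorem isUnit_of_injective [CompleteSpace E] {K : E →L[ℂ] E} (hK : IsCompactOperator K) {c : ℂ}
    (hc : c ≠ 0) (h : ∀ x, (c • 1 + K : E →L[ℂ] E) x = 0 → x = 0) :
    IsUnit (c • 1 + K : E →L[ℂ] E) := by
  have hK' : IsCompactOperator (-K : E →L[ℂ] E) := hK.neg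
  rcases hK'.hasEigenvalue_or_mem_resolventSet hc with h1 | h1
  · obtain ⟨x, hx⟩ := h1.exists_hasEigenvector
    refine absurd (h x ?_) hx.2
    have h2 : -K x = c • x := hx.apply_eq_smul
    simp [← h2]
  · rw [spectrum.mem_resolventSet_iff, Algebra.algebraMap_eq_smul_one, sub_neg_eq_add] at h1
    exact h1

theorem ker_shiftProd_mono (T : E →L[ℂ] E) (μ : ℂ) (l : List ℂ) :
    (shiftProd T l).ker ≤ (shiftProd T (μ :: l)).ker := by
  intro x hx
  have hx' : shiftProd T l x = 0 := hx
  change shiftProd T (μ :: l) x = 0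
  simp [hx']

/-- For a compact operator `T` and a set `R` of numbers bounded away from zero, the kernels of the
products of factors `T - μ` with `μ ∈ R` become stationary. -/
theorem exists_shiftProd_ker_stable {T : E →L[ℂ] E} (hT : IsCompactOperator T) {R : Set ℂ} {δ : ℝ}
    (hδ : 0 < δ) (hR : ∀ μ ∈ R, δ ≤ ‖μ‖) :
    ∃ l : List ℂ, (∀ μ ∈ l, μ ∈ R) ∧
      ∀ μ ∈ R, ∀ x, (T - μ • 1) (shiftProd T l x) = 0 → shiftProd T l x = 0 := by
  by_contra! hcon
  choose! f hfR g hg hg' using hcon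
  -- If the kernels never stabilize, prepending factors gives a strictly increasing chain; almost
  -- orthogonal unit vectors in it have images under `T` without a Cauchy subsequence.
  obtain ⟨s, hs0, hs1⟩ : ∃ s : ℕ → List ℂ, s 0 = [] ∧ ∀ n, s (n + 1) = f (s n) :: s n :=
    ⟨fun n => Nat.rec [] (fun _ l => f l :: l) n, rfl, fun _ => rfl⟩
  have hsR : ∀ n, ∀ μ ∈ s n, μ ∈ R := by
    intro n
    induction n with
    | zero => simp [hs0]
    | succ n ih =>
      intro μ hμ
      rw [hs1, List.mem_cons] at hμ
      rcases hμ with rfl | hμ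
      · exact hfR _ ih
      · exact ih μ hμ
  let N : ℕ → Submodule ℂ E := fun n => (shiftProd T (s n)).ker
  have hNmono : Monotone N := by
    refine monotone_nat_of_le_succ fun n => ?_
    change (shiftProd T (s n)).ker ≤ (shiftProd T (s (n + 1))).ker
    rw [hs1]
    exact ker_shiftProd_mono T _ _
  have hNT : ∀ n, ∀ x ∈ N n, T x ∈ N n := by
    intro n x hx
    have hx' : shiftProd T (s n) x = 0 := hx
    change shiftProd T (s n) (T x) = 0
    have h1 : T (shiftProd T (s n) x) = shiftProd T (s n) (T x) :=
      DFunLike.congr_fun (commute_shiftProd (Commute.refl T) (s n)).eq x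
    rw [← h1, hx', map_zero]
  have hy : ∀ n, ∃ y ∈ N (n + 1), ‖y‖ = 1 ∧ ∀ z ∈ N n, (1 / 2 : ℝ) ≤ ‖y - z‖ := by
    intro n
    have hcl : IsClosed (((N n).comap (N (n + 1)).subtype : Submodule ℂ (N (n + 1))) :
        Set (N (n + 1))) :=
      (shiftProd T (s n)).isClosed_ker.preimage continuous_subtype_val
    have hne : ∃ x : N (n + 1), x ∉ (N n).comap (N (n + 1)).subtype := by
      refine ⟨⟨g (s n), ?_⟩, ?_⟩
      · change shiftProd T (s (n + 1)) _ = 0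
        rw [hs1, shiftProd_cons]
        exact hg _ (hsR n)
      · exact hg' _ (hsR n)
    obtain ⟨y, -, hy1, hy2⟩ := riesz_lemma_of_lt_one (𝕜 := ℂ) hcl hne
      (show (1 / 2 : ℝ) < 1 by norm_num)
    refine ⟨y, y.2, hy1, fun z hz => ?_⟩
    have hz' : z ∈ N (n + 1) := hNmono n.le_succ hz
    have h1 := hy2 ⟨z, hz'⟩ hz
    exact h1
  choose y hyN hy1 hy2 using hy
  have hsep : ∀ m n, m < n → δ / 2 ≤ ‖T (y n) - T (y m)‖ := by
    intro m n hmn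
    set μ := f (s n) with hμ
    have hμR : δ ≤ ‖μ‖ := hR _ (hfR _ (hsR n))
    have hμ0 : μ ≠ 0 := norm_pos_iff.1 (hδ.trans_le hμR)
    have h1 : (T - μ • 1) (y n) ∈ N n := by
      change shiftProd T (s n) _ = 0
      rw [shift_shiftProd_apply]
      have := hyN n
      change shiftProd T (s (n + 1)) _ = 0 at this
      rw [hs1, shiftProd_cons] at this
      exact this
    have h2 : T (y m) ∈ N n := hNmono (Nat.succ_le_of_lt hmn) (hNT _ _ (hyN m))
    have h3 := hy2 n (μ⁻¹ • (T (y m) - (T - μ • 1) (y n)))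
      ((N n).smul_mem _ ((N n).sub_mem h2 h1))
    -- Modulo `N n`, `T` acts on `N (n + 1)` as `μ`; hence the separation is at least `|μ|` times
    -- the Riesz constant `1 / 2`.
    have h4 : T (y n) - T (y m) = μ • (y n - μ⁻¹ • (T (y m) - (T - μ • 1) (y n))) := by
      rw [smul_sub, smul_inv_smul₀ hμ0]
      simp
      abel
    rw [h4, norm_smul]
    calc δ / 2 = δ * (1 / 2) := by ring
      _ ≤ _ := mul_le_mul hμR h3 (by norm_num) (norm_nonneg _)
  obtain ⟨C, hC, hC'⟩ := hT.image_closedBall_subset_compact 1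
  obtain ⟨z, -, ψ, hψ, hψz⟩ := hC.tendsto_subseq
    (fun n => hC' ⟨y n, by simp [hy1], rfl⟩)
  have hcs := hψz.cauchySeq
  rw [Metric.cauchySeq_iff'] at hcs
  obtain ⟨n, hn⟩ := hcs (δ / 2) (by positivity)
  have h1 := hn (n + 1) n.le_succ
  rw [dist_eq_norm] at h1
  exact absurd (hsep _ _ (hψ n.lt_succ_self)) (not_le.2 h1)

/-- `π` is the spectral projection of `T` for the part of the spectrum in `R`; `l` lists points of
`R` such that the product of the `T - μ` vanishes on the range of `π`. -/
structure IsSpectralProjection (T : E →L[ℂ] E) (R : Set ℂ) (l : List ℂ) (π : E →L[ℂ] E) :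
    Prop where
  mem : ∀ μ ∈ l, μ ∈ R
  idem : π * π = π
  comm : Commute T π
  finite : FiniteDimensional ℂ π.range
  shiftProd_mul : shiftProd T l * π = 0
  isUnit_shiftProd_add : IsUnit (shiftProd T l + π)
  isUnit_shift : ∀ μ ∈ R, IsUnit ((T - μ • 1) * (1 - π) + π)

theorem isCompactOperator_of_finiteDimensional_range {Q : E →L[ℂ] E}
    (h : FiniteDimensional ℂ Q.range) : IsCompactOperator Q := by
  have : ProperSpace Q.range := FiniteDimensional.proper ℂ _
  exact (isCompactOperator_of_locallyCompactSpace_dom Q.rangeRestrict).clm_comp Q.range.subtypeL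

/-- Riesz decomposition of a compact operator. -/
theorem exists_isSpectralProjection [CompleteSpace E] {T : E →L[ℂ] E} (hT : IsCompactOperator T)
    {R : Set ℂ} {δ : ℝ} (hδ : 0 < δ) (hR : ∀ μ ∈ R, δ ≤ ‖μ‖) :
    ∃ (l : List ℂ) (π : E →L[ℂ] E), IsSpectralProjection T R l π := by
  have hR0 : ∀ μ ∈ R, μ ≠ 0 := fun μ hμ => norm_pos_iff.1 (hδ.trans_le (hR μ hμ))
  obtain ⟨l, hlR, hl⟩ := exists_shiftProd_ker_stable hT hδ hR
  obtain ⟨c, hc, K, hK, hP⟩ := shiftProd_eq_smul_add_compact hT l fun μ hμ => hR0 μ (hlR μ hμ)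
  set P := shiftProd T l with hPdef
  -- Each `T - μ` with `μ ∈ R` is injective on the range of `P`, so the factors of one copy of `P`
  -- can be peeled off one by one.
  have hker : ∀ x, P (P x) = 0 → P x = 0 := by
    have key : ∀ l' : List ℂ, (∀ μ ∈ l', μ ∈ R) → ∀ x, P (shiftProd T l' x) = 0 → P x = 0 := by
      intro l'
      induction l' with
      | nil => intro _ x hx; simpa using hx
      | cons μ l' ih =>
        intro h x hx
        rw [shiftProd_cons] at hx
        change P ((T - μ • 1) (shiftProd T l' x)) = 0 at hx
        rw [hPdef, shift_shiftProd_apply] at hx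
        exact ih (fun ν hν => h ν (List.mem_cons_of_mem _ hν)) x (hl μ (h μ List.mem_cons_self) _ hx)
    exact key l hlR
  -- On `ker P` the identity equals the compact operator `-c⁻¹ K`.
  have hfd : FiniteDimensional ℂ P.ker := by
    have hcl : IsClosed (P.ker : Set E) := P.isClosed_ker
    have hKN : ∀ x ∈ P.ker, K x ∈ P.ker := by
      intro x hx
      have hx' : P x = 0 := hx
      have h1 : K x = -(c • x) := by
        rw [hP] at hx'
        change c • x + K x = 0 at hx'
        exact eq_neg_of_add_eq_zero_right hx'
      rw [h1]
      exact Submodule.neg_mem _ (Submodule.smul_mem _ _ hx)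
    have h1 : IsCompactOperator ((K : E →ₗ[ℂ] E).restrict hKN) :=
      IsCompactOperator.restrict (f := (K : E →ₗ[ℂ] E)) hK hKN hcl
    have h2 : IsCompactOperator ((-c⁻¹) • ((K : E →ₗ[ℂ] E).restrict hKN)) := h1.smul (-c⁻¹)
    refine FiniteDimensional.of_isCompactOperator_id (𝕜 := ℂ) ?_
    suffices h3 : (id : P.ker → P.ker) = ⇑((-c⁻¹) • ((K : E →ₗ[ℂ] E).restrict hKN)) by
      rw [h3]; exact h2
    funext x
    apply Subtype.ext
    have hx' : P x = 0 := x.2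
    have hx2 : P x = c • (x : E) + K x := DFunLike.congr_fun hP (x : E)
    rw [hx2] at hx'
    have h1 : K x = -(c • (x : E)) := eq_neg_of_add_eq_zero_right hx'
    simp [LinearMap.restrict_apply, h1, smul_smul, hc]
  have hunit : ∀ Q : E →L[ℂ] E, (∀ x, P (Q x) = 0) → (∀ x, P x = 0 → Q x = x) →
      IsCompactOperator Q ∧ IsUnit (P + Q) := by
    intro Q hQ1 hQ2
    have hQK : IsCompactOperator Q := by
      apply isCompactOperator_of_finiteDimensional_range
      refine Submodule.finiteDimensional_of_le (S₂ := P.ker) ?_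
      rintro _ ⟨x, rfl⟩
      exact hQ1 x
    refine ⟨hQK, ?_⟩
    rw [hP, add_assoc]
    refine isUnit_of_injective (hK.add hQK) hc fun x hx => ?_
    rw [← add_assoc, ← hP] at hx
    have hx' : P x + Q x = 0 := hx
    have h1 : P (P x) = 0 := by
      rw [eq_neg_of_add_eq_zero_left hx', map_neg, hQ1, neg_zero]
    have h2 := hker x h1
    rw [h2, zero_add, hQ2 x h2] at hx'
    exact hx'
  obtain ⟨q, hq⟩ := Submodule.ClosedComplemented.of_finiteDimensional P.ker
  let Q : E →L[ℂ] E := P.ker.subtypeL ∘L q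
  have hQ1 : ∀ x, P (Q x) = 0 := fun x => (q x).2
  have hQ2 : ∀ x, P x = 0 → Q x = x := fun x hx => congrArg Subtype.val (hq ⟨x, hx⟩)
  obtain ⟨u, hu⟩ := (hunit Q hQ1 hQ2).2
  let v : E →L[ℂ] E := ↑u⁻¹
  have hv : ∀ x, v (P x + Q x) = x := fun x => by
    have := DFunLike.congr_fun u.inv_mul x
    rw [hu] at this
    exact this
  have hv' : ∀ x, P (v x) + Q (v x) = x := fun x => by
    have := DFunLike.congr_fun u.mul_inv x
    rw [hu] at this
    exact this
  -- `Q` is some projection onto `ker P`; composing with `(P + Q)⁻¹` yields the one along the range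
  -- of `P`, which commutes with `T`.
  let π : E →L[ℂ] E := Q * v
  have hπ1 : ∀ x, P (π x) = 0 := fun x => hQ1 _
  have hπ2 : ∀ x, P x = 0 → π x = x := by
    intro x hx
    have h := hv x
    rw [hx, zero_add, hQ2 x hx] at h
    change Q (v x) = x
    rw [h, hQ2 x hx]
  have hπP : ∀ x, π (P x) = 0 := by
    intro x
    have h := hv (x - Q x)
    rw [map_sub, hQ1, sub_zero, map_sub Q, hQ2 _ (hQ1 x), sub_self, add_zero] at h
    change Q (v (P x)) = 0
    rw [h, map_sub, hQ2 _ (hQ1 x), sub_self]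
  have hTP : ∀ x, P (T x) = T (P x) := fun x =>
    (DFunLike.congr_fun (commute_shiftProd (Commute.refl T) l).eq x).symm
  have hdec : ∀ x, ∃ y, x = P y + π x := fun x => ⟨v x, (hv' x).symm⟩
  have hidem : π * π = π := by ext x; exact hπ2 _ (hπ1 x)
  have hcomm : Commute T π := by
    ext x
    change T (π x) = π (T x)
    obtain ⟨y, hy⟩ := hdec x
    have h1 : T x = P (T y) + T (π x) := by rw [hTP, ← map_add, ← hy]
    rw [h1, map_add, hπP, zero_add]
    exact (hπ2 _ (by rw [hTP, hπ1, map_zero])).symm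
  obtain ⟨hπK, hπU⟩ := hunit π hπ1 hπ2
  refine ⟨l, π, hlR, hidem, hcomm, ?_, ?_, hπU, ?_⟩
  · refine Submodule.finiteDimensional_of_le (S₂ := P.ker) ?_
    rintro _ ⟨x, rfl⟩
    exact hπ1 x
  · ext x; exact hπ1 x
  · intro μ hμ
    -- This operator is `T - μ` on the range of `P` and the identity on `ker P`. It is a compact
    -- perturbation of `-μ`, so injectivity suffices.
    have h1 : (T - μ • 1) * (1 - π) + π = (-μ) • 1 + (T * (1 - π) + (μ + 1) • π) := by
      ext x
      simp
      module
    have h2 : IsCompactOperator (T * (1 - π) + (μ + 1) • π : E →L[ℂ] E) :=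
      (isCompactOperator_mul_right hT (1 - π)).add (hπK.smul (μ + 1))
    rw [h1]
    refine isUnit_of_injective h2 (neg_ne_zero.2 (hR0 μ hμ)) fun x hx => ?_
    rw [← h1] at hx
    have hx' : (T - μ • 1) (x - π x) + π x = 0 := hx
    have hππ : π (π x) = π x := hπ2 _ (hπ1 x)
    have hTπ : ∀ z, π (T z) = T (π z) := fun z => (DFunLike.congr_fun hcomm.eq z).symm
    have h3 : π x = 0 := by
      have := congrArg π hx'
      simpa [hTπ, hππ] using this
    rw [h3, sub_zero, add_zero] at hx'
    obtain ⟨y, hy⟩ := hdec x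
    rw [h3, add_zero] at hy
    rw [hy] at hx' ⊢
    exact hl μ hμ y hx'

end Riesz

/-! ### Deforming a spectral projection: Sylvester and Riccati equations -/

section Perturbation

open Filter Topology

variable {E : Type*} [NormedAddCommGroup E] [NormedSpace ℂ E]

/-- The corner of the Riccati equation for a projection onto an invariant subspace that is a graph
over the range of `π`. -/
def riccati (π : E →L[ℂ] E) (p : (E →L[ℂ] E) × (E →L[ℂ] E)) : E →L[ℂ] E :=
  (1 - π) * (p.1 * (π + (1 - π) * p.2 * π) -
    (π + (1 - π) * p.2 * π) * p.1 * (π + (1 - π) * p.2 * π)) * π + (p.2 - (1 - π) * p.2 * π)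

theorem contDiff_riccati (π : E →L[ℂ] E) : ContDiff ℂ 1 (riccati π) := by
  unfold riccati
  fun_prop

/-- The commutator of `k` with a polynomial in `T` telescopes into a commutator with `T`; `h` is the
resulting difference quotient. It stays in the corner because `T` commutes with `π`. -/
theorem exists_sylvester_shiftProd {T π : E →L[ℂ] E} (hc : Commute T π) (l : List ℂ)
    (k : E →L[ℂ] E) (hk : (1 - π) * k * π = k) :
    ∃ h : E →L[ℂ] E, (1 - π) * h * π = h ∧
      T * h - h * T = shiftProd T l * k - k * shiftProd T l := by
  induction l with
  | nil => exact ⟨0, by simp, by simp⟩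
  | cons μ l ih =>
    obtain ⟨h, hh, he⟩ := ih
    have hc1 : Commute (1 - π) (T - μ • 1) :=
      commute_shift ((Commute.one_left T).sub_left hc.symm) μ
    have hc2 : Commute π (shiftProd T l) := commute_shiftProd hc.symm l
    have hc3 : Commute (T - μ • 1) (shiftProd T l) :=
      commute_shiftProd (commute_shift (Commute.refl T) μ).symm l
    have hc4 : Commute T (shiftProd T l) := commute_shiftProd (Commute.refl T) l
    refine ⟨(T - μ • 1) * h + k * shiftProd T l, ?_, ?_⟩
    · have h1 : (1 - π) * ((T - μ • 1) * h) * π = (T - μ • 1) * h := by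
        rw [← mul_assoc, hc1.eq, mul_assoc, mul_assoc, ← mul_assoc (1 - π), hh]
      have h2 : (1 - π) * (k * shiftProd T l) * π = k * shiftProd T l := by
        rw [mul_assoc, mul_assoc, ← hc2.eq, ← mul_assoc k, ← mul_assoc, ← mul_assoc, hk]
      rw [mul_add, add_mul, h1, h2]
    · rw [shiftProd_cons]
      have h1 : T * ((T - μ • 1) * h) - (T - μ • 1) * h * T =
          (T - μ • 1) * (T * h - h * T) := by
        simp only [mul_sub, sub_mul, smul_mul_assoc, mul_smul_comm, one_mul, mul_assoc]
      have h2 : T * (k * shiftProd T l) - k * shiftProd T l * T =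
          (T - μ • 1) * (k * shiftProd T l) - k * ((T - μ • 1) * shiftProd T l) := by
        rw [mul_assoc k, ← hc4.eq]
        simp only [mul_sub, sub_mul, smul_mul_assoc, mul_smul_comm, one_mul]
        abel
      rw [mul_add, add_mul, add_sub_add_comm, h1, h2, he]
      simp only [mul_sub, sub_mul, smul_mul_assoc, mul_smul_comm, one_mul, mul_assoc]
      abel

namespace IsSpectralProjection

variable {T : E →L[ℂ] E} {R : Set ℂ} {l : List ℂ} {π : E →L[ℂ] E}

theorem one_sub_mul (h : IsSpectralProjection T R l π) : (1 - π) * π = 0 := by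
  rw [sub_mul, h.idem, one_mul, sub_self]

theorem mul_one_sub (h : IsSpectralProjection T R l π) : π * (1 - π) = 0 := by
  rw [mul_sub, h.idem, mul_one, sub_self]

theorem one_sub_mul_self (h : IsSpectralProjection T R l π) : (1 - π) * (1 - π) = 1 - π := by
  rw [mul_sub, h.one_sub_mul, mul_one, sub_zero]

theorem shiftProd_add_mul (h : IsSpectralProjection T R l π) {k : E →L[ℂ] E}
    (hk : (1 - π) * k * π = k) : (shiftProd T l + π) * k = shiftProd T l * k := by
  have h1 : π * k = 0 := by rw [← hk, ← mul_assoc, ← mul_assoc, h.mul_one_sub, zero_mul, zero_mul]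
  rw [add_mul, h1, add_zero]

theorem mul_shiftProd (h : IsSpectralProjection T R l π) {k : E →L[ℂ] E}
    (hk : (1 - π) * k * π = k) : k * shiftProd T l = 0 := by
  rw [← hk, mul_assoc, (commute_shiftProd h.comm.symm l).eq, h.shiftProd_mul, mul_zero]

/-- The Sylvester operator is injective on the off-diagonal corner. -/
theorem eq_zero_of_sylvester (h : IsSpectralProjection T R l π) {k : E →L[ℂ] E}
    (hk : (1 - π) * k * π = k) (he : T * k = k * T) : k = 0 := by
  have h1 : Commute k (shiftProd T l) := commute_shiftProd he.symm l
  have h2 : (shiftProd T l + π) * k = 0 := by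
    rw [h.shiftProd_add_mul hk, ← h1.eq, h.mul_shiftProd hk]
  exact (h.isUnit_shiftProd_add.mul_right_eq_zero).1 h2

/-- The Sylvester operator is surjective on the off-diagonal corner. -/
theorem exists_sylvester (h : IsSpectralProjection T R l π) {k : E →L[ℂ] E}
    (hk : (1 - π) * k * π = k) : ∃ g, (1 - π) * g * π = g ∧ T * g - g * T = k := by
  obtain ⟨g, hg, he⟩ := exists_sylvester_shiftProd h.comm l k hk
  -- On the corner the product kills `k` from the right and acts from the left as the unit `P + π`,
  -- where `P = shiftProd T l`. Dividing by this unit, which commutes with `T` and `π`, solves the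
  -- equation.
  rw [h.mul_shiftProd hk, sub_zero, ← h.shiftProd_add_mul hk] at he
  obtain ⟨u, hu⟩ := h.isUnit_shiftProd_add
  rw [← hu] at he
  have hTu : Commute T (u : E →L[ℂ] E) := by
    rw [hu]; exact (commute_shiftProd (Commute.refl T) l).add_right h.comm
  have hπu : Commute (1 - π) (u : E →L[ℂ] E) := by
    rw [hu]
    refine (Commute.one_left _).sub_left ?_
    exact (commute_shiftProd h.comm.symm l).add_right (Commute.refl π)
  refine ⟨(↑u⁻¹ : E →L[ℂ] E) * g, ?_, ?_⟩
  · rw [← mul_assoc, hπu.units_inv_right.eq, mul_assoc, mul_assoc, ← mul_assoc (1 - π), hg]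
  · rw [← mul_assoc, hTu.units_inv_right.eq, mul_assoc, mul_assoc, ← mul_sub, he, ← mul_assoc,
      u.inv_mul, one_mul]

theorem riccati_smul (h : IsSpectralProjection T R l π) (k : E →L[ℂ] E) (s : ℂ) :
    riccati π (T, s • k) = s • (T * ((1 - π) * k * π) - (1 - π) * k * π * T +
      (k - (1 - π) * k * π)) - s ^ 2 • ((1 - π) * k * π * T * ((1 - π) * k * π)) := by
  have e1 : (1 - π) * (s • k) * π = s • ((1 - π) * k * π) := by
    rw [mul_smul_comm, smul_mul_assoc]
  set m := (1 - π) * k * π with hm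
  have e2 : (1 - π) * m = m := by rw [hm, ← mul_assoc, ← mul_assoc, h.one_sub_mul_self]
  have e3 : m * π = m := by rw [hm, mul_assoc, h.idem]
  have e4 : (1 - π) * T = T * (1 - π) := ((Commute.one_left T).sub_left h.comm.symm).eq
  have e5 : (1 - π) * (T * π) = 0 := by rw [← mul_assoc, e4, mul_assoc, h.one_sub_mul, mul_zero]
  have e6 : (1 - π) * (T * m) = T * m := by rw [← mul_assoc, e4, mul_assoc, e2]
  have e7 : m * T * π = m * T := by rw [mul_assoc, h.comm.eq, ← mul_assoc, e3]
  have e8 : (π + s • m) * π = π + s • m := by rw [add_mul, h.idem, smul_mul_assoc, e3]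
  have e9 : (1 - π) * (π + s • m) = s • m := by
    rw [mul_add, h.one_sub_mul, zero_add, mul_smul_comm, e2]
  have e10 : (1 - π) * (T * (π + s • m)) = s • (T * m) := by
    rw [mul_add, mul_add, e5, zero_add, mul_smul_comm, mul_smul_comm, e6]
  simp only [riccati, e1]
  have : (1 - π) * (T * (π + s • m) - (π + s • m) * T * (π + s • m)) * π =
      s • (T * m) - s • m * T * (π + s • m) := by
    have e11 : (1 - π) * ((π + s • m) * T * (π + s • m)) * π = s • m * T * (π + s • m) := by
      rw [← mul_assoc (1 - π), ← mul_assoc (1 - π), e9, mul_assoc (s • m * T), e8]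
    rw [mul_sub, e10, sub_mul, e11, smul_mul_assoc, mul_assoc T, e3]
  rw [this, mul_add, smul_mul_assoc, smul_mul_assoc, e7, smul_mul_assoc, mul_smul_comm]
  module

/-- The quadratic term drops out at `0`, leaving the Sylvester operator on the corner. The last
summand is the identity on the complement of the corner, so that the derivative can be inverted on
the whole operator space. -/
theorem fderiv_riccati (h : IsSpectralProjection T R l π) (k : E →L[ℂ] E) :
    fderiv ℂ (riccati π) (T, 0) (0, k) =
      T * ((1 - π) * k * π) - (1 - π) * k * π * T + (k - (1 - π) * k * π) := by
  have h1 : HasFDerivAt (riccati π) (fderiv ℂ (riccati π) (T, 0)) (T, (0 : ℂ) • k) := by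
    rw [zero_smul]
    exact ((contDiff_riccati π).differentiable one_ne_zero _).hasFDerivAt
  have h2 : HasDerivAt (fun s : ℂ => (T, s • k)) ((0 : E →L[ℂ] E), k) 0 := by
    have := ((hasDerivAt_id (0 : ℂ)).smul_const k)
    simp only [one_smul] at this
    exact (hasDerivAt_const (0 : ℂ) T).prodMk this
  have h3 := h1.comp_hasDerivAt (0 : ℂ) h2
  have h4 : riccati π ∘ (fun s : ℂ => (T, s • k)) =
      fun s : ℂ => s • (T * ((1 - π) * k * π) - (1 - π) * k * π * T +
      (k - (1 - π) * k * π)) - s ^ 2 • ((1 - π) * k * π * T * ((1 - π) * k * π)) :=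
    funext fun s => h.riccati_smul k s
  rw [h4] at h3
  have h5 := ((hasDerivAt_id (0 : ℂ)).smul_const (T * ((1 - π) * k * π) - (1 - π) * k * π * T +
      (k - (1 - π) * k * π))).sub
      ((hasDerivAt_pow 2 (0 : ℂ)).smul_const ((1 - π) * k * π * T * ((1 - π) * k * π)))
  have h6 := h3.unique h5
  simpa using h6

theorem fderiv_riccati_isInvertible [CompleteSpace E] (h : IsSpectralProjection T R l π) :
    (fderiv ℂ (riccati π) (T, 0) ∘L .inr ℂ (E →L[ℂ] E) (E →L[ℂ] E)).IsInvertible := by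
  set D := fderiv ℂ (riccati π) (T, 0) ∘L .inr ℂ (E →L[ℂ] E) (E →L[ℂ] E)
  have hD : ∀ k, D k = T * ((1 - π) * k * π) - (1 - π) * k * π * T + (k - (1 - π) * k * π) :=
    fun k => h.fderiv_riccati k
  have hcorner : ∀ k, (1 - π) * ((1 - π) * k * π) * π = (1 - π) * k * π := by
    intro k
    rw [mul_assoc, mul_assoc, h.idem, ← mul_assoc, ← mul_assoc, h.one_sub_mul_self]
  have e4 : (1 - π) * T = T * (1 - π) := ((Commute.one_left T).sub_left h.comm.symm).eq
  have hcorner' : ∀ m, (1 - π) * m * π = m → (1 - π) * (T * m - m * T) * π = T * m - m * T := by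
    intro m hm
    have h1 : (1 - π) * (T * m) * π = T * m := by
      rw [← mul_assoc, e4, mul_assoc, mul_assoc, ← mul_assoc (1 - π), hm]
    have h2 : (1 - π) * (m * T) * π = m * T := by
      rw [mul_assoc, mul_assoc, h.comm.eq, ← mul_assoc, ← mul_assoc, hm]
    rw [mul_sub, sub_mul, h1, h2]
  have hinj : D.ker = ⊥ := by
    rw [LinearMap.ker_eq_bot']
    intro k hk
    have hk' : D k = 0 := hk
    rw [hD] at hk'
    set m := (1 - π) * k * π with hm
    have h1 := hcorner k
    rw [← hm] at h1
    have h2 : (1 - π) * (T * m - m * T + (k - m)) * π = 0 := by rw [hk']; simp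
    rw [mul_add, add_mul, hcorner' m h1, mul_sub, sub_mul, h1, ← hm, sub_self, add_zero] at h2
    rw [h2, zero_add] at hk'
    have h3 := h.eq_zero_of_sylvester h1 (sub_eq_zero.1 h2)
    rw [h3, sub_zero] at hk'
    exact hk'
  have hsurj : D.range = ⊤ := by
    rw [LinearMap.range_eq_top]
    intro k
    obtain ⟨g, hg, he⟩ := h.exists_sylvester (hcorner k)
    refine ⟨g + (k - (1 - π) * k * π), ?_⟩
    change D _ = k
    have h1 : (1 - π) * (g + (k - (1 - π) * k * π)) * π = g := by
      rw [mul_add, add_mul, hg, mul_sub, sub_mul, hcorner, sub_self, add_zero]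
    rw [hD, h1, he]
    abel
  exact ⟨ContinuousLinearEquiv.ofBijective D hinj hsurj, ContinuousLinearEquiv.coe_ofBijective ..⟩

/-- A spectral projection of `T` deforms to projections onto invariant subspaces of operators
close to `T`. -/
theorem exists_deformation [CompleteSpace E] (h : IsSpectralProjection T R l π) :
    ∃ J : (E →L[ℂ] E) → E →L[ℂ] E, Tendsto J (𝓝 T) (𝓝 π) ∧
      ∀ᶠ S in 𝓝 T, π * J S = π ∧ J S * π = J S ∧ S * J S = J S * S * J S := by
  have hs : HasStrictFDerivAt (riccati π) (fderiv ℂ (riccati π) (T, 0)) (T, 0) :=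
    (contDiff_riccati π).contDiffAt.hasStrictFDerivAt one_ne_zero
  have hinv := h.fderiv_riccati_isInvertible
  let ψ := hs.implicitFunctionOfProdDomain hinv
  have hψ : Tendsto ψ (𝓝 T) (𝓝 0) := hs.tendsto_implicitFunctionOfProdDomain hinv
  have hψe : ∀ᶠ S in 𝓝 T, riccati π (S, ψ S) = riccati π (T, 0) :=
    hs.eventually_apply_implicitFunctionOfProdDomain hinv
  have h0 : riccati π (T, 0) = 0 := by
    have := h.riccati_smul 0 0
    simpa using this
  refine ⟨fun S => π + (1 - π) * ψ S * π, ?_, ?_⟩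
  · have : Tendsto (fun S => π + (1 - π) * ψ S * π) (𝓝 T) (𝓝 (π + (1 - π) * 0 * π)) :=
      ((hψ.const_mul (1 - π)).mul_const π).const_add π
    simpa using this
  · filter_upwards [hψe] with S hS
    rw [h0] at hS
    simp only [riccati] at hS
    set g := ψ S
    set j := π + (1 - π) * g * π with hj
    have h1 : π * j = π := by
      rw [hj, mul_add, h.idem, ← mul_assoc, ← mul_assoc, h.mul_one_sub, zero_mul, zero_mul,
        add_zero]
    have h2 : j * π = j := by
      rw [hj, add_mul, h.idem, mul_assoc, h.idem]
    refine ⟨h1, h2, ?_⟩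
    have h3 : (1 - π) * (S * j - j * S * j) * π = (1 - π) * (S * j - j * S * j) := by
      simp only [mul_sub, sub_mul, mul_assoc, h2]
    rw [h3] at hS
    have h4 : π * (S * j - j * S * j) = 0 := by
      rw [mul_sub, ← mul_assoc π (j * S), ← mul_assoc π j, h1, ← mul_assoc π S, sub_self]
    have h5 : (1 - π) * (S * j - j * S * j) = S * j - j * S * j := by
      rw [sub_mul, h4, one_mul, sub_zero]
    have h6 : (1 - π) * (g - (1 - π) * g * π) * π = 0 := by
      have : (1 - π) * ((1 - π) * g * π) * π = (1 - π) * g * π := by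
        rw [mul_assoc, mul_assoc, h.idem, ← mul_assoc, ← mul_assoc, h.one_sub_mul_self]
      rw [mul_sub, sub_mul, this, sub_self]
    -- Compression to the corner separates the two summands of the equation: it kills the
    -- complementary one and fixes the invariance defect.
    have h7 : (1 - π) * ((1 - π) * (S * j - j * S * j) + (g - (1 - π) * g * π)) * π = 0 := by
      rw [hS]; simp
    rw [mul_add, add_mul, h6, add_zero, h5, h3, h5] at h7
    exact sub_eq_zero.1 h7

end IsSpectralProjection

/-- The sum of the generalized eigenspaces of `T` at the points of `R`. -/
noncomputable def spectralSubspace (T : E →L[ℂ] E) (R : Set ℂ) : Submodule ℂ E :=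
  ⨆ μ ∈ R, Module.End.maxGenEigenspace (T : E →ₗ[ℂ] E) μ

theorem shiftProd_apply_of_eigenvector {T : E →L[ℂ] E} {μ : ℂ} {x : E} (hx : T x = μ • x)
    (l : List ℂ) : shiftProd T l x = (l.map fun ν => μ - ν).prod • x := by
  induction l with
  | nil => simp
  | cons ν l ih =>
    rw [shiftProd_cons, List.map_cons, List.prod_cons]
    change (T - ν • 1) (shiftProd T l x) = _
    rw [ih, map_smul]
    simp [hx]
    module

theorem pow_length_le_norm_prod {d : ℝ} (hd : 0 < d) {μ : ℂ} (l : List ℂ)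
    (h : ∀ ν ∈ l, d ≤ ‖μ - ν‖) : d ^ l.length ≤ ‖(l.map fun ν => μ - ν).prod‖ := by
  induction l with
  | nil => simp
  | cons ν l ih =>
    rw [List.map_cons, List.prod_cons, norm_mul, List.length_cons, pow_succ']
    exact mul_le_mul (h ν List.mem_cons_self) (ih fun ξ hξ => h ξ (List.mem_cons_of_mem _ hξ))
      (by positivity) (norm_nonneg _)

/-- Criterion for the range of a projection to be the spectral subspace. -/
theorem spectralSubspace_eq_range {S J : E →L[ℂ] E} {R : Set ℂ}
    (hJ : J * J = J) (hJfd : FiniteDimensional ℂ J.range) (hSJ : S * J = J * S * J)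
    (hin : ∀ μ, μ ∉ R → ∀ x, J x = x → S x = μ • x → x = 0)
    (hout : ∀ μ ∈ R, ∀ x, J ((S - μ • 1) x) = (S - μ • 1) x → J x = x) :
    spectralSubspace S R = J.range := by
  have hmem : ∀ x, x ∈ J.range ↔ J x = x := by
    intro x
    constructor
    · rintro ⟨y, rfl⟩
      exact DFunLike.congr_fun hJ y
    · intro hx
      exact ⟨x, hx⟩
  have hinv : ∀ x ∈ J.range, (S : E →ₗ[ℂ] E) x ∈ J.range := by
    intro x hx
    rw [hmem] at hx ⊢
    have := DFunLike.congr_fun hSJ x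
    change S (J x) = J (S (J x)) at this
    rw [hx] at this
    exact this.symm
  apply le_antisymm
  · refine iSup₂_le fun μ hμ x hx => ?_
    rw [Module.End.mem_maxGenEigenspace] at hx
    obtain ⟨k, hk⟩ := hx
    induction k generalizing x with
    | zero =>
      have : x = 0 := by simpa using hk
      rw [this]; exact Submodule.zero_mem _
    | succ k ih =>
      rw [pow_succ] at hk
      have h1 := ih _ hk
      rw [hmem] at h1
      rw [hmem]
      exact hout μ hμ x h1
  -- The range is finite-dimensional and `S`-invariant, hence spanned by generalized eigenspaces of
  -- the restriction; `hin` removes those for `μ ∉ R`.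
  · have htop := Module.End.iSup_maxGenEigenspace_eq_top ((S : E →ₗ[ℂ] E).restrict hinv)
    have h1 : J.range = (⊤ : Submodule ℂ J.range).map J.range.subtype := by
      rw [Submodule.map_top, Submodule.range_subtype]
    rw [h1, ← htop, Submodule.map_iSup]
    refine iSup_le fun μ => ?_
    by_cases hμ : μ ∈ R
    · rw [Module.End.maxGenEigenspace, ← Submodule.inf_genEigenspace]
      exact inf_le_right.trans (le_iSup₂_of_le μ hμ le_rfl)
    · suffices h2 : Module.End.maxGenEigenspace ((S : E →ₗ[ℂ] E).restrict hinv) μ = ⊥ by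
        rw [h2, Submodule.map_bot]; exact bot_le
      rw [eq_bot_iff]
      intro x hx
      rw [Module.End.mem_maxGenEigenspace] at hx
      obtain ⟨k, hk⟩ := hx
      induction k generalizing x with
      | zero => simpa using hk
      | succ k ih =>
        rw [pow_succ] at hk
        have h3 := ih hk
        rw [Submodule.mem_bot] at h3 ⊢
        have h4 : S x - μ • (x : E) = 0 := congrArg Subtype.val h3
        exact Subtype.ext (hin μ hμ x ((hmem _).1 x.2) (sub_eq_zero.1 h4))

/-- `J` maps the range of `π` onto its own range, and `π` does the same in the other direction, so
neither dimension exceeds the other. -/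
theorem finrank_range_eq_of_mul {π J : E →L[ℂ] E} (hπ : FiniteDimensional ℂ π.range)
    (h1 : π * J = π) (h2 : J * π = J) :
    FiniteDimensional ℂ J.range ∧ Module.finrank ℂ J.range = Module.finrank ℂ π.range := by
  have e1 : J.range = π.range.map (J : E →ₗ[ℂ] E) := by
    rw [← LinearMap.range_comp]
    congr 1
    ext x
    exact (DFunLike.congr_fun h2 x).symm
  have e2 : π.range = J.range.map (π : E →ₗ[ℂ] E) := by
    rw [← LinearMap.range_comp]
    congr 1
    ext x
    exact (DFunLike.congr_fun h1 x).symm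
  have hJ : FiniteDimensional ℂ J.range := by rw [e1]; infer_instance
  refine ⟨hJ, le_antisymm ?_ ?_⟩
  · rw [e1]; exact Submodule.finrank_map_le _ _
  · rw [e2]; exact Submodule.finrank_map_le _ _

/-- The dimension of the spectral subspace is stable under small perturbations which create no
eigenvalues in a punctured neighbourhood of `R`. -/
theorem IsSpectralProjection.eventually_finrank_eq [CompleteSpace E] {T : E →L[ℂ] E} {R : Set ℂ}
    {l : List ℂ} {π : E →L[ℂ] E} (h : IsSpectralProjection T R l π) (hR : IsCompact R)
    {U : Set ℂ} (hU : IsOpen U) (hRU : R ⊆ U) :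
    ∀ᶠ S in 𝓝 T, (∀ μ ∈ U \ R, ∀ x, S x = μ • x → x = 0) →
      FiniteDimensional ℂ (spectralSubspace S R) ∧
        Module.finrank ℂ (spectralSubspace S R) = Module.finrank ℂ π.range := by
  obtain ⟨J, hJ, hJe⟩ := h.exists_deformation
  have hB : ∀ᶠ p : (E →L[ℂ] E) × (E →L[ℂ] E) in 𝓝 (T, π), ∀ μ ∈ R,
      IsUnit ((p.1 - p.2 * p.1 - μ • 1) * (1 - π) + π) := by
    refine hR.eventually_forall_of_forall_eventually fun μ hμ => ?_
    have hcont : Continuous fun z : ((E →L[ℂ] E) × (E →L[ℂ] E)) × ℂ =>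
        (z.1.1 - z.1.2 * z.1.1 - z.2 • 1) * (1 - π) + π := by fun_prop
    refine hcont.continuousAt.eventually (Units.isOpen.mem_nhds ?_)
    have h1 : (T - π * T - μ • 1) * (1 - π) + π = (T - μ • 1) * (1 - π) + π := by
      have : π * T * (1 - π) = 0 := by
        rw [← h.comm.eq, mul_assoc, h.mul_one_sub, mul_zero]
      rw [sub_right_comm, sub_mul _ (π * T), this, sub_zero]
    change IsUnit ((T - π * T - μ • 1) * (1 - π) + π)
    rw [h1]
    exact h.isUnit_shift μ hμ
  have hTJ : Tendsto (fun S => (S, J S)) (𝓝 T) (𝓝 (T, π)) := tendsto_id.prodMk_nhds hJ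
  obtain ⟨d, hd, hdU⟩ := hR.exists_thickening_subset_open hU hRU
  -- On an eigenvector in the range of `J S` the product acts as `∏ (μ - ν)`. This bound forces some
  -- factor below `d`, so `μ` is within `d` of `R` and lies in `U`.
  have hP : ∀ᶠ S in 𝓝 T, ‖shiftProd S l * J S‖ < d ^ l.length := by
    have hcont : Continuous fun S : E →L[ℂ] E => shiftProd S l := by
      clear hdU hB h
      induction l with
      | nil => simpa using continuous_const
      | cons ν l ih => simp only [shiftProd_cons]; fun_prop
    have h1 : Tendsto (fun S => ‖shiftProd S l * J S‖) (𝓝 T) (𝓝 ‖shiftProd T l * π‖) :=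
      ((hcont.tendsto T).mul hJ).norm
    rw [h.shiftProd_mul, norm_zero] at h1
    exact h1.eventually_lt_const (by positivity)
  filter_upwards [hJe, hTJ.eventually hB, hP] with S ⟨h1, h2, h3⟩ h4 h5 h6
  have hJJ : J S * J S = J S := by
    calc J S * J S = J S * π * J S := by rw [h2]
      _ = J S := by rw [mul_assoc, h1, h2]
  obtain ⟨hfd, hrk⟩ := finrank_range_eq_of_mul h.finite h1 h2
  suffices hs : spectralSubspace S R = (J S).range by rw [hs]; exact ⟨hfd, hrk⟩
  refine spectralSubspace_eq_range hJJ hfd h3 ?_ ?_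
  · intro μ hμ x hx hSx
    by_contra hx0
    have hμU : μ ∉ U := fun hμU => hx0 (h6 μ ⟨hμU, hμ⟩ x hSx)
    have h7 : d ^ l.length ≤ ‖(l.map fun ν => μ - ν).prod‖ := by
      refine pow_length_le_norm_prod hd l fun ν hν => ?_
      by_contra hlt
      refine hμU (hdU ?_)
      rw [Metric.mem_thickening_iff]
      exact ⟨ν, h.mem ν hν, by rw [dist_eq_norm]; exact not_le.1 hlt⟩
    have h8 : (shiftProd S l * J S) x = (l.map fun ν => μ - ν).prod • x := by
      change shiftProd S l (J S x) = _
      rw [hx, shiftProd_apply_of_eigenvector hSx]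
    have h9 := (shiftProd S l * J S).le_opNorm x
    rw [h8, norm_smul] at h9
    have h10 := le_of_mul_le_mul_right h9 (norm_pos_iff.2 hx0)
    linarith
  · intro μ hμ x hx
    have hπJ : ∀ y, π (J S y) = π y := fun y => DFunLike.congr_fun h1 y
    have hJJx : ∀ y, J S (J S y) = J S y := fun y => DFunLike.congr_fun hJJ y
    have hSJ : ∀ y, S (J S y) = J S (S (J S y)) := fun y => DFunLike.congr_fun h3 y
    -- If `(S - μ) x` lies in the range of `J S`, then `x - J S x` is killed by the operator that
    -- `h4` declares invertible; here `π (x - J S x) = 0`.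
    have hy : ((S - J S * S - μ • 1) * (1 - π) + π) (x - J S x) = 0 := by
      change (S - J S * S - μ • 1) ((x - J S x) - π (x - J S x)) + π (x - J S x) = 0
      rw [map_sub π, hπJ, sub_self, sub_zero, add_zero]
      have hx' : J S (S x) - μ • J S x = S x - μ • x := by simpa using hx
      change S (x - J S x) - J S (S (x - J S x)) - μ • (x - J S x) = 0
      rw [map_sub, map_sub, ← hSJ, smul_sub]
      have : J S (S x) = S x - μ • x + μ • J S x := by rw [← hx']; abel
      rw [this]
      abel
    obtain ⟨u, hu⟩ := h4 μ hμ
    have h7 : x - J S x = (↑u⁻¹ : E →L[ℂ] E) ((u : E →L[ℂ] E) (x - J S x)) :=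
      (DFunLike.congr_fun u.inv_mul (x - J S x)).symm
    rw [hu, hy, map_zero] at h7
    exact (sub_eq_zero.1 h7).symm

end Perturbation

/-! ### Invariance of the dimension along paths, and eigenvalues in the range of the projection -/

section Homotopy

open Filter Topology

variable {E : Type*} [NormedAddCommGroup E] [NormedSpace ℂ E]

theorem exists_isSpectralProjection_of_isCompact [CompleteSpace E] {T : E →L[ℂ] E}
    (hT : IsCompactOperator T) {R : Set ℂ} (hR : IsCompact R) (h0 : (0 : ℂ) ∉ R) :
    ∃ (l : List ℂ) (π : E →L[ℂ] E), IsSpectralProjection T R l π := by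
  obtain ⟨δ, hδ, hδR⟩ := Metric.mem_nhds_iff.1 (hR.isClosed.isOpen_compl.mem_nhds h0)
  refine exists_isSpectralProjection hT hδ fun μ hμ => ?_
  by_contra hlt
  exact hδR (by simpa using hlt) hμ

/-- The dimension of the spectral subspace is constant along a path of compact operators without
eigenvalues in a punctured neighbourhood of `R`. -/
theorem finrank_spectralSubspace_path [CompleteSpace E] {T : unitInterval → E →L[ℂ] E}
    (hT : Continuous T) (hTc : ∀ t, IsCompactOperator (T t)) {R U : Set ℂ} (hR : IsCompact R)
    (h0 : (0 : ℂ) ∉ R) (hU : IsOpen U) (hRU : R ⊆ U)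
    (hUR : ∀ t, ∀ μ ∈ U \ R, ∀ x, T t x = μ • x → x = 0) (s t : unitInterval) :
    Module.finrank ℂ (spectralSubspace (T s) R) = Module.finrank ℂ (spectralSubspace (T t) R) := by
  have hloc : IsLocallyConstant fun t => Module.finrank ℂ (spectralSubspace (T t) R) := by
    rw [IsLocallyConstant.iff_eventually_eq]
    intro t
    obtain ⟨l, π, h⟩ := exists_isSpectralProjection_of_isCompact (hTc t) hR h0
    have h1 := h.eventually_finrank_eq hR hU hRU
    filter_upwards [(hT.tendsto t).eventually h1] with t' ht'
    rw [(ht' (hUR t')).2, (h1.self_of_nhds (hUR t)).2]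
  exact hloc.apply_eq_of_preconnectedSpace s t

theorem IsSpectralProjection.apply_eq_self {T : E →L[ℂ] E} {R : Set ℂ} {l : List ℂ}
    {π : E →L[ℂ] E} (h : IsSpectralProjection T R l π) {μ : ℂ} (hμ : μ ∈ R) {x : E}
    (hx : T x = μ • x) : π x = x := by
  obtain ⟨u, hu⟩ := h.isUnit_shift μ hμ
  have hππ : ∀ y, π (π y) = π y := fun y => DFunLike.congr_fun h.idem y
  have hTπ : T (π x) = π (T x) := DFunLike.congr_fun h.comm.eq x
  have h1 : ((T - μ • 1) * (1 - π) + π) (x - π x) = 0 := by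
    change (T - μ • 1) (x - π x - π (x - π x)) + π (x - π x) = 0
    rw [map_sub π, hππ, sub_self, sub_zero, add_zero]
    change T (x - π x) - μ • (x - π x) = 0
    rw [map_sub, hTπ, hx, map_smul, smul_sub, sub_self]
  have h2 : x - π x = (↑u⁻¹ : E →L[ℂ] E) ((u : E →L[ℂ] E) (x - π x)) :=
    (DFunLike.congr_fun u.inv_mul (x - π x)).symm
  rw [hu, h1, map_zero] at h2
  exact (sub_eq_zero.1 h2).symm

/-- The product vanishes on the range of `π` but multiplies an eigenvector by `∏ (μ - ν)`. This is
the source of the finiteness of the eigenvalues in `R`. -/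
theorem IsSpectralProjection.mem_list {T : E →L[ℂ] E} {R : Set ℂ} {l : List ℂ}
    {π : E →L[ℂ] E} (h : IsSpectralProjection T R l π) {μ : ℂ} {x : E} (hπ : π x = x) (hx0 : x ≠ 0)
    (hx : T x = μ • x) : μ ∈ l := by
  have h1 : shiftProd T l x = 0 := by
    have := DFunLike.congr_fun h.shiftProd_mul x
    change shiftProd T l (π x) = 0 at this
    rwa [hπ] at this
  rw [shiftProd_apply_of_eigenvector hx, smul_eq_zero, or_iff_left hx0, List.prod_eq_zero_iff,
    List.mem_map] at h1
  obtain ⟨ν, hν, hμν⟩ := h1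
  rwa [sub_eq_zero.1 hμν]

/-- The kernel of the spectral projection is contained in the range of `T - μ` for `μ ∈ R`. -/
theorem IsSpectralProjection.exists_shift_eq {T : E →L[ℂ] E} {R : Set ℂ} {l : List ℂ}
    {π : E →L[ℂ] E} (h : IsSpectralProjection T R l π) {μ : ℂ} (hμ : μ ∈ R) (x : E) :
    ∃ w, (T - μ • 1) w = x - π x := by
  obtain ⟨u, hu⟩ := h.isUnit_shift μ hμ
  have hππ : ∀ y, π (π y) = π y := fun y => DFunLike.congr_fun h.idem y
  have hTπ : ∀ y, T (π y) = π (T y) := fun y => DFunLike.congr_fun h.comm.eq y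
  set v := (↑u⁻¹ : E →L[ℂ] E) (x - π x)
  have h1 : (u : E →L[ℂ] E) v = x - π x := DFunLike.congr_fun u.mul_inv (x - π x)
  rw [hu] at h1
  change (T - μ • 1) (v - π v) + π v = x - π x at h1
  have h2 : π v = 0 := by
    have h3 := congrArg π h1
    have h4 : π ((T - μ • 1) (v - π v)) = 0 := by
      change π (T (v - π v) - μ • (v - π v)) = 0
      rw [map_sub, ← hTπ, map_smul, map_sub, hππ, sub_self, map_zero, smul_zero, sub_zero]
    rw [map_add, h4, hππ, zero_add, map_sub, hππ, sub_self] at h3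
    exact h3
  refine ⟨v, ?_⟩
  rw [h2, sub_zero, add_zero] at h1
  exact h1

theorem finrank_biSup_of_iSupIndep {ι : Type*} {V : ι → Submodule ℂ E} (hV : iSupIndep V)
    (F : Finset ι) (hfd : ∀ i ∈ F, FiniteDimensional ℂ (V i)) :
    FiniteDimensional ℂ (⨆ i ∈ F, V i : Submodule ℂ E) ∧
    Module.finrank ℂ (⨆ i ∈ F, V i : Submodule ℂ E) = ∑ i ∈ F, Module.finrank ℂ (V i) := by
  classical
  induction F using Finset.induction_on with
  | empty =>
    have h1 : (⨆ i ∈ (∅ : Finset ι), V i) = ⊥ := by simp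
    rw [h1]
    exact ⟨inferInstance, by simp⟩
  | insert a F ha ih =>
    have h1 := hfd a (Finset.mem_insert_self _ _)
    obtain ⟨h2, ih⟩ := ih fun i hi => hfd i (Finset.mem_insert_of_mem hi)
    rw [Finset.iSup_insert, Finset.sum_insert ha, ← ih]
    refine ⟨Submodule.finiteDimensional_sup _ _, ?_⟩
    have h3 : Disjoint (V a) (⨆ i ∈ F, V i) := hV.disjoint_biSup ha
    have h4 := Submodule.finrank_sup_add_finrank_inf_eq (V a) (⨆ i ∈ F, V i)
    rw [h3.eq_bot, finrank_bot, add_zero] at h4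
    exact h4

end Homotopy

/-! ### Resolvents of bounded perturbations and root spaces -/

section Resolvent

variable {E : Type*} [NormedAddCommGroup E] [NormedSpace ℂ E] {L : E →ₗ.[ℂ] E} {z : ℂ}
  {T : E →L[ℂ] E}

/-- If `T` is the resolvent of `L` at `z`, this is the resolvent of `L - A` at `z`. -/
noncomputable def perturbedResolvent (T A : E →L[ℂ] E) : E →L[ℂ] E :=
  T * Ring.inverse (1 - A * T)

/-- Fredholm alternative: if `y = A T y`, then `T y` solves `(L - z - A) T y = 0`, so `T y = 0` and
`y = 0`. -/
theorem IsResolventAt.isUnit_one_sub_mul [CompleteSpace E] (h : IsResolventAt L z T)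
    (hT : IsCompactOperator T) (A : E →L[ℂ] E)
    (hA : ∀ x : L.domain, L x = z • (x : E) + A x → (x : E) = 0) : IsUnit (1 - A * T) := by
  have h1 : IsCompactOperator (-(A * T) : E →L[ℂ] E) := (isCompactOperator_mul_left hT A).neg
  have h2 : (1 - A * T : E →L[ℂ] E) = (1 : ℂ) • 1 + -(A * T) := by rw [one_smul, sub_eq_add_neg]
  rw [h2]
  refine isUnit_of_injective h1 one_ne_zero fun y hy => ?_
  rw [← h2] at hy
  have hy' : y - A (T y) = 0 := hy
  have h3 := h.right_inv y
  have h4 : T y = 0 := by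
    refine hA ⟨T y, h.mem_domain y⟩ ?_
    change L ⟨T y, h.mem_domain y⟩ = z • T y + A (T y)
    rw [← sub_eq_zero.1 hy', sub_eq_iff_eq_add'.1 h3]
  rw [h4, map_zero, sub_zero] at hy'
  exact hy'

theorem IsResolventAt.perturbedResolvent_mem (h : IsResolventAt L z T) (A : E →L[ℂ] E) (y : E) :
    perturbedResolvent T A y ∈ L.domain :=
  h.mem_domain _

theorem IsResolventAt.apply_perturbedResolvent (h : IsResolventAt L z T) {A : E →L[ℂ] E}
    (hA : IsUnit (1 - A * T)) (y : E) :
    L ⟨perturbedResolvent T A y, h.perturbedResolvent_mem A y⟩ =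
      z • perturbedResolvent T A y + A (perturbedResolvent T A y) + y := by
  set v := Ring.inverse (1 - A * T) y with hv
  have h1 : v - A (T v) = y := DFunLike.congr_fun (Ring.mul_inverse_cancel _ hA) y
  have h2 := h.right_inv v
  change L ⟨T v, h.mem_domain v⟩ = z • T v + A (T v) + y
  rw [← h1, add_assoc, add_sub_cancel, ← sub_eq_iff_eq_add']
  exact h2

theorem IsResolventAt.perturbedResolvent_apply (h : IsResolventAt L z T) {A : E →L[ℂ] E}
    (hA : IsUnit (1 - A * T)) (x : L.domain) :
    perturbedResolvent T A (L x - z • (x : E) - A x) = x := by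
  have h1 := h.left_inv x
  set w := L x - z • (x : E)
  have h2 : w - A x = (1 - A * T) w := by
    change w - A x = w - A (T w)
    rw [h1]
  change T (Ring.inverse (1 - A * T) (w - A x)) = x
  have h3 : Ring.inverse (1 - A * T) ((1 - A * T) w) = w :=
    DFunLike.congr_fun (Ring.inverse_mul_cancel _ hA) w
  rw [h2, h3, h1]

/-- Outside its eigenvalues, an operator with compact resolvent has a compact resolvent. -/
theorem IsResolventAt.exists_of_notMem_eigenvalues [CompleteSpace E] (h : IsResolventAt L z T)
    (hT : IsCompactOperator T) {w : ℂ} (hw : w ∉ eigenvalues L) :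
    ∃ T' : E →L[ℂ] E, IsResolventAt L w T' ∧ IsCompactOperator T' := by
  have hA : IsUnit (1 - ((w - z) • 1 : E →L[ℂ] E) * T) := by
    refine h.isUnit_one_sub_mul hT _ fun x hx => ?_
    by_contra hx0
    refine hw ⟨x, hx0, ?_⟩
    rw [hx]
    change z • (x : E) + (w - z) • (x : E) = _
    module
  refine ⟨perturbedResolvent T ((w - z) • 1), ⟨h.perturbedResolvent_mem _, fun y => ?_,
    fun x => ?_⟩, isCompactOperator_mul_right hT _⟩
  · rw [h.apply_perturbedResolvent hA]
    set v := perturbedResolvent T ((w - z) • 1) y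
    change z • v + (w - z) • v + y - w • v = y
    module
  · have h1 := h.perturbedResolvent_apply hA x
    convert h1 using 2
    change _ = L x - z • (x : E) - (w - z) • (x : E)
    module

/-- An eigenvector of the perturbed resolvent is an eigenvector of the perturbed operator. -/
theorem IsResolventAt.eigenvector_of_perturbedResolvent (h : IsResolventAt L z T)
    {A : E →L[ℂ] E} (hA : IsUnit (1 - A * T)) {μ : ℂ} (hμ : μ ≠ 0) {x : E}
    (hx : perturbedResolvent T A x = μ • x) :
    ∃ hxD : x ∈ L.domain, L ⟨x, hxD⟩ = (z + μ⁻¹) • x + A x := by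
  have hxD : x ∈ L.domain := by
    have := L.domain.smul_mem μ⁻¹ (h.perturbedResolvent_mem A x)
    rwa [hx, inv_smul_smul₀ hμ] at this
  refine ⟨hxD, ?_⟩
  have h1 := h.apply_perturbedResolvent hA x
  have h2 : (⟨perturbedResolvent T A x, h.perturbedResolvent_mem A x⟩ : L.domain) =
      μ • ⟨x, hxD⟩ := Subtype.ext hx
  rw [h2, hx, L.map_smul, map_smul] at h1
  have h3 : L ⟨x, hxD⟩ = μ⁻¹ • (μ • L ⟨x, hxD⟩) := (inv_smul_smul₀ hμ _).symm
  rw [h3, h1, smul_add, smul_add, inv_smul_smul₀ hμ, smul_comm z, inv_smul_smul₀ hμ]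
  module

/-- With `N = T - (w - z)⁻¹` and `y = (L - z) x`, one has `x = T y` and `(L - w) x = -(w - z) N y`.
As `T` is injective and commutes with `N`, each factor `L - w` corresponds to one factor `N`. -/
theorem IsResolventAt.mem_powKer_iff (h : IsResolventAt L z T) {w : ℂ} (hw : w ≠ z) (n : ℕ)
    (x : E) : x ∈ powKer L w n ↔
      (((T : E →ₗ[ℂ] E) - (w - z)⁻¹ • (1 : Module.End ℂ E)) ^ n) x = 0 := by
  have hwz : w - z ≠ 0 := sub_ne_zero.2 hw
  set μ := (w - z)⁻¹ with hμ
  set N : Module.End ℂ E := (T : E →ₗ[ℂ] E) - μ • (1 : Module.End ℂ E) with hN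
  have hNx : ∀ x, N x = T x - μ • x := fun x => rfl
  have hTN : Commute (T : Module.End ℂ E) N :=
    (Commute.refl _).sub_right ((Commute.one_right _).smul_right μ)
  have hTinj : ∀ y, T y = 0 → y = 0 := by
    intro y hy
    have h1 := h.right_inv y
    have h2 : (⟨T y, h.mem_domain y⟩ : L.domain) = 0 := Subtype.ext hy
    rw [h2, L.map_zero, hy, smul_zero, sub_zero] at h1
    exact h1.symm
  induction n generalizing x with
  | zero => simp [powKer]
  | succ n ih =>
    rw [mem_powKer_succ]
    have key : ∀ hxD : x ∈ L.domain,
        (N ^ n) (L ⟨x, hxD⟩ - w • x) = 0 ↔ (N ^ (n + 1)) x = 0 := by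
      intro hxD
      set y := L ⟨x, hxD⟩ - z • x with hy
      have hTy : T y = x := h.left_inv ⟨x, hxD⟩
      have h1 : L ⟨x, hxD⟩ - w • x = -(w - z) • N y := by
        rw [hNx, smul_sub, smul_smul, hTy, neg_mul, hμ, mul_inv_cancel₀ hwz, hy]
        module
      have h2 : (N ^ (n + 1)) x = T ((N ^ (n + 1)) y) := by
        have := DFunLike.congr_fun (hTN.pow_right (n + 1)).eq y
        change T ((N ^ (n + 1)) y) = (N ^ (n + 1)) (T y) at this
        rw [this, hTy]
      rw [h1, map_smul, smul_eq_zero, or_iff_right (neg_ne_zero.2 hwz), h2, pow_succ]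
      change (N ^ n) (N y) = 0 ↔ T ((N ^ n) (N y)) = 0
      exact ⟨fun h => by rw [h, map_zero], hTinj _⟩
    constructor
    · rintro ⟨hxD, hx⟩
      exact (key hxD).1 ((ih _).1 hx)
    · intro hx
      have h1 : N x ∈ powKer L w n := by
        rw [pow_succ] at hx
        exact (ih _).2 hx
      have h2 : N x ∈ L.domain := by
        cases n with
        | zero =>
          have : N x = 0 := by simpa [powKer] using h1
          rw [this]; exact L.domain.zero_mem
        | succ n => exact ((mem_powKer_succ L w n _).1 h1).1
      -- Since `x = (w - z) (T x - N x)`, domain membership of `N x` passes to `x`.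
      have h3 : x ∈ L.domain := by
        have h4 := L.domain.smul_mem (w - z) (L.domain.sub_mem (h.mem_domain x) h2)
        rw [hNx, sub_sub_cancel, hμ, smul_inv_smul₀ hwz] at h4
        exact h4
      exact ⟨h3, (ih _).2 ((key h3).2 hx)⟩

theorem IsResolventAt.rootSpace_eq (h : IsResolventAt L z T) {w : ℂ} (hw : w ≠ z) :
    rootSpace L w = Module.End.maxGenEigenspace (T : E →ₗ[ℂ] E) (w - z)⁻¹ := by
  apply le_antisymm
  · refine iSup_le fun n x hx => ?_
    rw [Module.End.mem_maxGenEigenspace]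
    exact ⟨n, (h.mem_powKer_iff hw n x).1 hx⟩
  · intro x hx
    rw [Module.End.mem_maxGenEigenspace] at hx
    obtain ⟨n, hn⟩ := hx
    exact le_iSup (powKer L w) n ((h.mem_powKer_iff hw n x).2 hn)

end Resolvent

/-! ### Coordinates, Gershgorin disks and the damped operators -/

section Gershgorin

open Filter Topology

variable {E : Type*} [NormedAddCommGroup E] [NormedSpace ℂ E] {b : SchauderBasis ℂ E}
  {l : ℕ → ℕ → ℂ}

theorem eq_zero_of_coord_eq_zero {x : E} (hx : ∀ i, b.coord i x = 0) : x = 0 := by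
  have h1 := SchauderBasis.tendsto_proj b x
  have h2 : (fun n => SchauderBasis.proj b n x) = fun _ => 0 := by
    funext n
    simp [SchauderBasis.proj_apply, hx]
  rw [h2] at h1
  exact tendsto_nhds_unique h1 tendsto_const_nhds

theorem coord_basis_self (i : ℕ) : b.coord i (b i) = 1 := by simp [b.ortho]

theorem coord_basis_of_ne {i j : ℕ} (h : i ≠ j) : b.coord i (b j) = 0 := by simp [b.ortho, h]

theorem exists_norm_coord_le [CompleteSpace E]
    (hE : ∀ x : E, ∃ i₀ : ℕ, ∀ i : ℕ, ‖b.coord i x‖ ≤ ‖b.coord i₀ x‖) :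
    ∃ C : ℝ, ∀ i, ‖b.coord i‖ ≤ C :=
  banach_steinhaus fun x => let ⟨i₀, h⟩ := hE x; ⟨‖b.coord i₀ x‖, h⟩

theorem tendsto_coord_smul (x : E) : Tendsto (fun i => b.coord i x • b i) atTop (𝓝 0) := by
  have h1 := SchauderBasis.tendsto_proj b x
  have h2 := (h1.comp (tendsto_add_atTop_nat 1)).sub h1
  rw [sub_self] at h2
  refine h2.congr fun n => ?_
  simp [SchauderBasis.proj_apply, Finset.sum_range_succ]

/-- If all coordinate sequences attain their maximum modulus, they tend to zero. -/
theorem tendsto_coord [CompleteSpace E]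
    (hE : ∀ x : E, ∃ i₀ : ℕ, ∀ i : ℕ, ‖b.coord i x‖ ≤ ‖b.coord i₀ x‖) (x : E) :
    Tendsto (fun i => b.coord i x) atTop (𝓝 0) := by
  by_contra hcon
  rw [NormedAddGroup.tendsto_nhds_zero] at hcon
  push Not at hcon
  obtain ⟨ε, hε, hfreq⟩ := hcon
  -- The terms `x_i b_i` of the expansion tend to zero; where `|x_i| ≥ ε`, the basis vectors must be
  -- small.
  have hsmall : ∀ k : ℕ, ∃ᶠ i in atTop, ‖b i‖ ≤ (1 / 2 : ℝ) ^ k := by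
    intro k
    have h1 : ∀ᶠ i in atTop, ‖b.coord i x • b i‖ < ε * (1 / 2 : ℝ) ^ k :=
      (NormedAddGroup.tendsto_nhds_zero.1 (tendsto_coord_smul x)) _ (by positivity)
    have hfreq' : ∃ᶠ i in atTop, ε ≤ ‖b.coord i x‖ := hfreq.mono fun i hi => by simpa using hi
    refine (hfreq'.and_eventually h1).mono fun i ⟨hi, hi'⟩ => ?_
    rw [norm_smul] at hi'
    by_contra hlt
    exact absurd hi' (not_lt.2 (mul_le_mul hi (not_le.1 hlt).le (by positivity) (norm_nonneg _)))
  obtain ⟨φ, hφ, hφb⟩ := extraction_forall_of_frequently hsmall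
  -- Coordinates strictly increasing to `1` have no maximum, contradicting `hE`. The shift by `2`
  -- makes `c 0` positive, which rules out indices outside the range of `φ`.
  set c : ℕ → ℂ := fun k => ((1 - 1 / (k + 2) : ℝ) : ℂ) with hc
  have hpos : ∀ k : ℕ, (0 : ℝ) < 1 / (k + 2) := fun k => by positivity
  have hle : ∀ k : ℕ, (1 : ℝ) / (k + 2) ≤ 1 / 2 := fun k => by
    apply one_div_le_one_div_of_le (by norm_num)
    have : (0 : ℝ) ≤ k := k.cast_nonneg
    linarith
  have hcn : ∀ k, ‖c k‖ = 1 - 1 / (k + 2) := by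
    intro k
    rw [hc, Complex.norm_real, Real.norm_eq_abs, abs_of_nonneg]
    have := hle k
    linarith
  have hsum : Summable fun k => c k • b (φ k) := by
    refine Summable.of_norm_bounded (g := fun k => (1 / 2 : ℝ) ^ k) summable_geometric_two
      fun k => ?_
    rw [norm_smul]
    have h1 : ‖c k‖ ≤ 1 := by rw [hcn]; have := hpos k; linarith
    calc ‖c k‖ * ‖b (φ k)‖ ≤ 1 * (1 / 2 : ℝ) ^ k :=
          mul_le_mul h1 (hφb k) (norm_nonneg _) zero_le_one
      _ = _ := one_mul _
  set y := ∑' k, c k • b (φ k)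
  have hy : ∀ i, HasSum (fun k => c k * b.coord i (b (φ k))) (b.coord i y) := by
    intro i
    have := (b.coord i).hasSum hsum.hasSum
    simpa using this
  have hy1 : ∀ k, b.coord (φ k) y = c k := by
    intro k
    have h2 : HasSum (fun m => c m * b.coord (φ k) (b (φ m))) (c k * b.coord (φ k) (b (φ k))) := by
      refine hasSum_single k fun m hm => ?_
      rw [coord_basis_of_ne (hφ.injective.ne hm.symm), mul_zero]
    rw [(hy _).unique h2, coord_basis_self, mul_one]
  have hy2 : ∀ i, i ∉ Set.range φ → b.coord i y = 0 := by
    intro i hi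
    refine (hy i).unique ?_
    have : (fun k => c k * b.coord i (b (φ k))) = fun _ => 0 := by
      funext k
      rw [coord_basis_of_ne (fun h => hi ⟨k, h.symm⟩), mul_zero]
    rw [this]
    exact hasSum_zero
  obtain ⟨i₀, hi₀⟩ := hE y
  by_cases hi : i₀ ∈ Set.range φ
  · obtain ⟨k, rfl⟩ := hi
    have h1 := hi₀ (φ (k + 1))
    rw [hy1, hy1, hcn, hcn] at h1
    have h2 : (1 : ℝ) / ((k + 1 : ℕ) + 2) < 1 / (k + 2) := by
      apply one_div_lt_one_div_of_lt (by positivity)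
      push_cast
      linarith
    linarith
  · have h1 := hi₀ (φ 0)
    rw [hy1, hy2 i₀ hi, norm_zero, hcn] at h1
    have := hle 0
    linarith

/-- The off-diagonal part of the `i`-th row of the matrix `l`, as a functional. -/
noncomputable def rowFunctional (b : SchauderBasis ℂ E) (l : ℕ → ℕ → ℂ) (i : ℕ) : E →L[ℂ] ℂ :=
  ∑' j : {j : ℕ // j ≠ i}, l i j • b.coord j

theorem summable_norm_row {i : ℕ} (hr : radius l i ≠ ⊤) :
    Summable fun j : {j : ℕ // j ≠ i} => ‖l i j‖ := by
  rw [radius, ← Function.comp_def (fun z : ℂ => ‖z‖ₑ)] at hr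
  exact summable_norm_iff.2 (Summable.of_norm (by
    have := ENNReal.summable_toReal hr
    simpa [toReal_enorm] using this))

/-- A finite radius and uniformly bounded coordinate functionals make the defining series absolutely
convergent, so the `tsum` is not a default value. -/
theorem hasSum_rowFunctional {C : ℝ} (hC : ∀ i, ‖b.coord i‖ ≤ C) {i : ℕ} (hr : radius l i ≠ ⊤)
    (x : E) :
    HasSum (fun j : {j : ℕ // j ≠ i} => l i j * b.coord j x) (rowFunctional b l i x) := by
  have h1 : Summable fun j : {j : ℕ // j ≠ i} => l i j • b.coord j := by
    refine Summable.of_norm_bounded ((summable_norm_row hr).mul_right C) fun j => ?_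
    rw [norm_smul]
    exact mul_le_mul_of_nonneg_left (hC j) (norm_nonneg _)
  have h2 := (ContinuousLinearMap.apply ℂ ℂ x).hasSum h1.hasSum
  simpa [rowFunctional] using h2

theorem norm_rowFunctional_le {C : ℝ} (hC : ∀ i, ‖b.coord i‖ ≤ C) {i : ℕ}
    (hr : radius l i ≠ ⊤) {x : E} {m : ℝ} (hx : ∀ j, ‖b.coord j x‖ ≤ m) :
    ‖rowFunctional b l i x‖ ≤ (radius l i).toReal * m := by
  have hs := summable_norm_row hr
  have h1 : (radius l i).toReal = ∑' j : {j : ℕ // j ≠ i}, ‖l i j‖ := by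
    rw [radius, ENNReal.tsum_toReal_eq (fun j => enorm_ne_top)]
    simp [toReal_enorm]
  rw [← (hasSum_rowFunctional hC hr x).tsum_eq, h1, ← tsum_mul_right]
  refine tsum_of_norm_bounded (hs.mul_right m).hasSum fun j => ?_
  rw [norm_mul]
  exact mul_le_mul_of_nonneg_left (hx j) (norm_nonneg _)

theorem IsMatrixOf.coord_apply {L : E →ₗ.[ℂ] E} (hl : IsMatrixOf b L l) {C : ℝ}
    (hC : ∀ i, ‖b.coord i‖ ≤ C) {i : ℕ} (hr : radius l i ≠ ⊤) (x : L.domain) :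
    b.coord i (L x) = l i i * b.coord i (x : E) + rowFunctional b l i x := by
  have h1 := hasSum_rowFunctional hC hr (x : E)
  have h2 : HasSum (fun j => l i j * b.coord j (x : E))
      (l i i * b.coord i (x : E) + rowFunctional b l i x) := by
    have h3 : HasSum (fun j : ({i} : Set ℕ) => l i j * b.coord j (x : E))
        (l i i * b.coord i (x : E)) := by
      have := hasSum_unique (fun j : ({i} : Set ℕ) => l i j * b.coord j (x : E))
      simpa using this
    exact h3.add_isCompl (t := {j | j ≠ i}) isCompl_compl h1
  exact (hl x i).unique (h2.mono_left (SummationFilter.conditional ℕ).le_atTop)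

theorem disk_eq_closedBall {i : ℕ} (hr : radius l i ≠ ⊤) :
    disk l i = Metric.closedBall (l i i) (radius l i).toReal := by
  ext z
  rw [Metric.mem_closedBall, dist_eq_norm, disk, Set.mem_ofPred_eq,
    ← ENNReal.toReal_le_toReal enorm_ne_top hr, toReal_enorm]

theorem diag_mem_disk (i : ℕ) : l i i ∈ disk l i := by simp [disk]

/-- The Gershgorin argument for one row. -/
theorem mem_disk_of_row {C : ℝ} (hC : ∀ i, ‖b.coord i‖ ≤ C) {i : ℕ} {x : E} (hx : x ≠ 0)
    (hi : ∀ j, ‖b.coord j x‖ ≤ ‖b.coord i x‖) {z s : ℂ} (hs : ‖s‖ ≤ 1)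
    (h : radius l i ≠ ⊤ → (z - l i i) * b.coord i x = s * rowFunctional b l i x) :
    z ∈ disk l i := by
  by_cases hr : radius l i = ⊤
  · simp [disk, hr]
  have hpos : 0 < ‖b.coord i x‖ := by
    by_contra h0
    refine hx (eq_zero_of_coord_eq_zero (b := b) fun j => ?_)
    exact norm_le_zero_iff.1 ((hi j).trans (not_lt.1 h0))
  rw [disk_eq_closedBall hr, Metric.mem_closedBall, dist_eq_norm]
  refine le_of_mul_le_mul_right ?_ hpos
  rw [← norm_mul, h hr, norm_mul]
  calc ‖s‖ * ‖rowFunctional b l i x‖ ≤ 1 * ‖rowFunctional b l i x‖ :=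
        mul_le_mul_of_nonneg_right hs (norm_nonneg _)
    _ = ‖rowFunctional b l i x‖ := one_mul _
    _ ≤ _ := norm_rowFunctional_le hC hr hi

theorem eigenvalues_subset_iUnion_disk [CompleteSpace E]
    (hE : ∀ x : E, ∃ i₀ : ℕ, ∀ i : ℕ, ‖b.coord i x‖ ≤ ‖b.coord i₀ x‖) {L : E →ₗ.[ℂ] E}
    (hl : IsMatrixOf b L l) : eigenvalues L ⊆ ⋃ i, disk l i := by
  rintro z ⟨x, hx0, hx⟩
  obtain ⟨C, hC⟩ := exists_norm_coord_le hE
  obtain ⟨i, hi⟩ := hE x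
  refine Set.mem_iUnion.2 ⟨i, mem_disk_of_row hC hx0 hi (s := 1) (by simp) fun hr => ?_⟩
  have h1 := hl.coord_apply hC hr x
  rw [hx, map_smul, smul_eq_mul] at h1
  rw [sub_mul, h1]
  ring

/-- The off-diagonal part of the rows with index in `S`. -/
noncomputable def rowPart (b : SchauderBasis ℂ E) (l : ℕ → ℕ → ℂ) (S : Finset ℕ) : E →L[ℂ] E :=
  ∑ i ∈ S, (rowFunctional b l i).smulRight (b i)

theorem coord_rowPart (S : Finset ℕ) (i : ℕ) (x : E) :
    b.coord i (rowPart b l S x) = if i ∈ S then rowFunctional b l i x else 0 := by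
  simp [rowPart, b.ortho, Pi.single_apply]

/-- Gershgorin's theorem for the operators with partially damped rows. -/
theorem mem_disk_of_damped {C : ℝ} (hC : ∀ i, ‖b.coord i‖ ≤ C) {L : E →ₗ.[ℂ] E}
    (hl : IsMatrixOf b L l) (S : Finset ℕ) (t : unitInterval) {z : ℂ} {x : L.domain}
    (hx0 : (x : E) ≠ 0) (hx : L x = z • (x : E) + ((t : ℝ) : ℂ) • rowPart b l S x) {i : ℕ}
    (hi : ∀ j, ‖b.coord j (x : E)‖ ≤ ‖b.coord i (x : E)‖) : z ∈ disk l i := by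
  have h1 : radius l i ≠ ⊤ → z * b.coord i (x : E) + (t : ℝ) *
      (if i ∈ S then rowFunctional b l i x else 0) =
      l i i * b.coord i (x : E) + rowFunctional b l i x := by
    intro hr
    rw [← hl.coord_apply hC hr x, hx]
    simp only [map_add, map_smul, coord_rowPart, smul_eq_mul]
  by_cases hiS : i ∈ S
  -- In `L - t A` the off-diagonal part of a row in `S` is scaled by `1 - t`.
  · refine mem_disk_of_row hC hx0 hi (s := ((1 - t : ℝ) : ℂ)) ?_ fun hr => ?_
    · rw [Complex.norm_real, Real.norm_eq_abs, abs_of_nonneg (sub_nonneg.2 t.2.2)]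
      linarith [t.2.1]
    · have h2 := h1 hr
      rw [if_pos hiS] at h2
      push_cast
      linear_combination h2
  · refine mem_disk_of_row hC hx0 hi (s := 1) (by simp) fun hr => ?_
    have h2 := h1 hr
    rw [if_neg hiS] at h2
    linear_combination h2

/-- A disk equal to `ℂ` would meet every disk of the other family, and neither family is empty: `S`
is nonempty and finite. -/
theorem radius_ne_top_of_disjoint {S : Finset ℕ} (hS : S.Nonempty)
    (hdisj : Disjoint (⋃ i ∈ S, disk l i) (⋃ i ∈ (S : Set ℕ)ᶜ, disk l i)) (i : ℕ) :
    radius l i ≠ ⊤ := by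
  intro hi
  have huniv : disk l i = Set.univ := by simp [disk, hi]
  rw [Set.disjoint_left] at hdisj
  by_cases hiS : i ∈ S
  · obtain ⟨k, hk⟩ := S.exists_notMem
    refine hdisj (a := l k k) ?_ ?_
    · exact Set.mem_biUnion hiS (by rw [huniv]; trivial)
    · exact Set.mem_biUnion (show k ∈ (S : Set ℕ)ᶜ from hk) (diag_mem_disk k)
  · obtain ⟨k, hk⟩ := hS
    refine hdisj (a := l k k) ?_ ?_
    · exact Set.mem_biUnion hk (diag_mem_disk k)
    · exact Set.mem_biUnion (show i ∈ (S : Set ℕ)ᶜ from hiS) (by rw [huniv]; trivial)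

/-- A union of Gershgorin disks that is disjoint from all others has a neighbourhood in which the
damped operators have no further eigenvalues. -/
theorem exists_isolating_nhds [CompleteSpace E]
    (hE : ∀ x : E, ∃ i₀ : ℕ, ∀ i : ℕ, ‖b.coord i x‖ ≤ ‖b.coord i₀ x‖) {L : E →ₗ.[ℂ] E}
    (hl : IsMatrixOf b L l) {w : ℂ} {T : E →L[ℂ] E} (hT : IsResolventAt L w T)
    (hTc : IsCompactOperator T) {S : Finset ℕ} (hr : ∀ i, radius l i ≠ ⊤)
    (hR : IsCompact (⋃ i ∈ S, disk l i))
    (hdisj : Disjoint (⋃ i ∈ S, disk l i) (⋃ i ∈ (S : Set ℕ)ᶜ, disk l i)) :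
    ∃ U : Set ℂ, IsOpen U ∧ (⋃ i ∈ S, disk l i) ⊆ U ∧
      ∀ (t : unitInterval), ∀ z ∈ U, ∀ x : L.domain,
        L x = z • (x : E) + ((t : ℝ) : ℂ) • rowPart b l S x → (x : E) ≠ 0 →
          z ∈ ⋃ i ∈ S, disk l i := by
  obtain ⟨C, hC⟩ := exists_norm_coord_le hE
  set R := ⋃ i ∈ S, disk l i with hRdef
  by_contra! hcon
  -- Otherwise shrinking thickenings of `R` provide normalized eigenvectors with eigenvalues outside
  -- `R`, whose maximal coordinates therefore have indices outside `S`.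
  have hseq : ∀ n : ℕ, ∃ (t : unitInterval) (z : ℂ) (x : E) (i : ℕ),
      z ∈ Metric.thickening (1 / (n + 1 : ℝ)) R ∧ ‖x‖ = 1 ∧
      x = T ((z - w) • x + ((t : ℝ) : ℂ) • rowPart b l S x) ∧
      (∀ j, ‖b.coord j x‖ ≤ ‖b.coord i x‖) ∧ i ∉ S ∧ z ∈ disk l i := by
    intro n
    obtain ⟨t, z, hz, x, hx, hx0, hzR⟩ := hcon (Metric.thickening (1 / (n + 1 : ℝ)) R)
      Metric.isOpen_thickening (Metric.self_subset_thickening (by positivity) R)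
    obtain ⟨i, hi⟩ := hE x
    have hzi := mem_disk_of_damped hC hl S t hx0 hx hi
    refine ⟨t, z, ((‖(x : E)‖ : ℂ)⁻¹) • (x : E), i, hz, norm_smul_inv_norm hx0, ?_, ?_, ?_, hzi⟩
    · have h1 := hT.left_inv x
      rw [hx] at h1
      have h2 : z • (x : E) + ((t : ℝ) : ℂ) • rowPart b l S x - w • (x : E) =
          (z - w) • (x : E) + ((t : ℝ) : ℂ) • rowPart b l S x := by module
      rw [h2] at h1
      rw [map_smul (rowPart b l S), smul_comm (z - w), smul_comm ((t : ℝ) : ℂ), ← smul_add,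
        map_smul T, h1]
    · intro j
      simp only [map_smul, norm_smul]
      exact mul_le_mul_of_nonneg_left (hi j) (norm_nonneg _)
    · intro hiS
      exact hzR (Set.mem_biUnion hiS hzi)
  choose t z x i hz hx1 hxT hi hiS hzi using hseq
  have hzc : ∀ n, z n ∈ Metric.cthickening 1 R := by
    intro n
    refine Metric.thickening_subset_cthickening_of_le ?_ R (hz n)
    rw [div_le_one (by positivity)]
    linarith [(n.cast_nonneg : (0 : ℝ) ≤ n)]
  obtain ⟨B, hB⟩ := (hR.cthickening (r := 1)).isBounded.exists_norm_le
  obtain ⟨K, hK, hK'⟩ := hTc.image_closedBall_subset_compact (B + ‖w‖ + ‖rowPart b l S‖)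
  have hxK : ∀ n, x n ∈ K := by
    intro n
    refine hK' ⟨(z n - w) • x n + ((t n : ℝ) : ℂ) • rowPart b l S (x n), ?_, (hxT n).symm⟩
    rw [mem_closedBall_zero_iff]
    refine (norm_add_le _ _).trans (add_le_add ?_ ?_)
    · rw [norm_smul, hx1, mul_one]
      exact (norm_sub_le _ _).trans (by linarith [hB _ (hzc n)])
    · rw [norm_smul, Complex.norm_real, Real.norm_eq_abs, abs_of_nonneg (t n).2.1]
      have h1 := (rowPart b l S).le_opNorm (x n)
      rw [hx1, mul_one] at h1
      calc (t n : ℝ) * ‖rowPart b l S (x n)‖ ≤ 1 * ‖rowPart b l S (x n)‖ :=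
            mul_le_mul_of_nonneg_right (t n).2.2 (norm_nonneg _)
        _ ≤ _ := by rw [one_mul]; exact h1
  obtain ⟨⟨y, ζ⟩, -, φ, hφ, hlim⟩ := (hK.prod (hR.cthickening (r := 1))).tendsto_subseq
    (x := fun n => (x n, z n)) fun n => ⟨hxK n, hzc n⟩
  have hy : Tendsto (fun n => x (φ n)) atTop (𝓝 y) := (continuous_fst.tendsto _).comp hlim
  have hζ : Tendsto (fun n => z (φ n)) atTop (𝓝 ζ) := (continuous_snd.tendsto _).comp hlim
  have hζR : ζ ∈ R := by
    rw [← hR.isClosed.closure_eq, Metric.mem_closure_iff_infEDist_zero]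
    have h1 : Tendsto (fun n => Metric.infEDist (z (φ n)) R) atTop (𝓝 (Metric.infEDist ζ R)) :=
      (Metric.continuous_infEDist.tendsto ζ).comp hζ
    have h2 : Tendsto (fun n : ℕ => ENNReal.ofReal (1 / ((φ n : ℕ) + 1 : ℝ))) atTop (𝓝 0) := by
      rw [← ENNReal.ofReal_zero]
      exact ENNReal.tendsto_ofReal
        (tendsto_one_div_add_atTop_nhds_zero_nat.comp hφ.tendsto_atTop)
    exact le_antisymm (le_of_tendsto_of_tendsto' h1 h2 fun n => (hz (φ n)).le) bot_le
  have hy1 : ‖y‖ = 1 := by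
    refine tendsto_nhds_unique hy.norm ?_
    simp [hx1]
  have hy0 : y ≠ 0 := norm_ne_zero_iff.1 (by rw [hy1]; norm_num)
  obtain ⟨k, hk⟩ : ∃ k, b.coord k y ≠ 0 := by
    by_contra! h
    exact hy0 (eq_zero_of_coord_eq_zero h)
  set m := ‖b.coord k y‖ with hm
  have hmpos : 0 < m := norm_pos_iff.2 hk
  have hfin : {j : ℕ | m / 3 ≤ ‖b.coord j y‖}.Finite := by
    have h1 := NormedAddGroup.tendsto_nhds_zero.1 (tendsto_coord hE y) (m / 3) (by positivity)
    rw [← Nat.cofinite_eq_atTop, eventually_cofinite] at h1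
    simpa using h1
  have hC0 : 0 ≤ C := (norm_nonneg _).trans (hC 0)
  -- A coordinatewise error of at most `m / 3` is spent twice, at `k` and at the maximal index,
  -- which leaves `m / 3` of `|y_k| = m`. As the coordinates of `y` tend to zero, only finitely many
  -- indices qualify, so one of them recurs.
  have hev : ∀ᶠ n in atTop, i (φ n) ∈ {j : ℕ | m / 3 ≤ ‖b.coord j y‖} := by
    have h1 : ∀ᶠ n in atTop, ‖x (φ n) - y‖ < m / (3 * (C + 1)) := by
      have := (tendsto_iff_norm_sub_tendsto_zero.1 hy)
      exact this.eventually_lt_const (by positivity)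
    filter_upwards [h1] with n hn
    have h2 : ∀ j, ‖b.coord j (x (φ n)) - b.coord j y‖ ≤ m / 3 := by
      intro j
      rw [← map_sub]
      calc ‖b.coord j (x (φ n) - y)‖ ≤ ‖b.coord j‖ * ‖x (φ n) - y‖ := (b.coord j).le_opNorm _
        _ ≤ (C + 1) * (m / (3 * (C + 1))) :=
            mul_le_mul ((hC j).trans (by linarith)) hn.le (norm_nonneg _) (by positivity)
        _ = m / 3 := by field_simp
    have h3 := hi (φ n) k
    have h4 := norm_sub_norm_le (b.coord k y) (b.coord k (x (φ n)))
    have h5 := norm_sub_norm_le (b.coord (i (φ n)) (x (φ n))) (b.coord (i (φ n)) y)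
    have h6 := h2 k
    rw [norm_sub_rev] at h6
    have h7 := h2 (i (φ n))
    change m / 3 ≤ _
    linarith
  obtain ⟨j, -, hj⟩ : ∃ j ∈ {j : ℕ | m / 3 ≤ ‖b.coord j y‖}, ∃ᶠ n in atTop, i (φ n) = j := by
    by_contra! h
    have h1 : ∀ᶠ n in atTop, ∀ j ∈ {j : ℕ | m / 3 ≤ ‖b.coord j y‖}, i (φ n) ≠ j := by
      rw [eventually_all_finite hfin]
      exact h
    obtain ⟨n, hn1, hn2⟩ := (hev.and h1).exists
    exact hn2 _ hn1 rfl
  have hjS : j ∉ S := by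
    obtain ⟨n, hn⟩ := hj.exists
    rw [← hn]
    exact hiS _
  have hζj : ζ ∈ disk l j := by
    have hcl : IsClosed (disk l j) := by
      rw [disk_eq_closedBall (hr j)]; exact Metric.isClosed_closedBall
    refine hcl.mem_of_frequently_of_tendsto (hj.mono fun n hn => ?_) hζ
    rw [← hn]
    exact hzi _
  exact Set.disjoint_left.1 hdisj hζR (Set.mem_biUnion (show j ∈ (S : Set ℕ)ᶜ from hjS) hζj)

end Gershgorin

/-! ### Counting eigenvalues -/

section Count

open Filter Topology

variable {E : Type*} [NormedAddCommGroup E] [NormedSpace ℂ E] {b : SchauderBasis ℂ E}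

/-- If finitely many coordinates are eigenfunctionals of `T` for points of `R`, and `T` has no
eigenvector for a point of `R` in their common kernel, then the spectral subspace has dimension the
number of these coordinates. -/
theorem IsSpectralProjection.finrank_range_eq_card {T : E →L[ℂ] E} {R : Set ℂ} {L : List ℂ}
    {π : E →L[ℂ] E} (h : IsSpectralProjection T R L π) {S : Finset ℕ} {ν : ℕ → ℂ}
    (hν : ∀ i ∈ S, ν i ∈ R) (hT : ∀ i ∈ S, ∀ x, b.coord i (T x) = ν i * b.coord i x)
    (hker : ∀ μ ∈ R, ∀ x, T x = μ • x → (∀ i ∈ S, b.coord i x = 0) → x = 0) :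
    Module.finrank ℂ π.range = S.card := by
  classical
  have hfd := h.finite
  let Φ : π.range →ₗ[ℂ] (S → ℂ) :=
    (LinearMap.pi fun i : S => ((b.coord i : E →L[ℂ] ℂ) : E →ₗ[ℂ] ℂ)) ∘ₗ π.range.subtype
  have hΦ : ∀ (x : π.range) (i : S), Φ x i = b.coord i (x : E) := fun x i => rfl
  have hππ : ∀ x ∈ π.range, π x = x := by
    rintro _ ⟨y, rfl⟩
    exact DFunLike.congr_fun h.idem y
  have hTπ : ∀ y, T (π y) = π (T y) := fun y => DFunLike.congr_fun h.comm.eq y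
  -- `x - π x` lies in the range of `T - ν i`, which the eigenfunctional `b.coord i` annihilates.
  have hcoordπ : ∀ i ∈ S, ∀ x, b.coord i (π x) = b.coord i x := by
    intro i hi x
    obtain ⟨w, hw⟩ := h.exists_shift_eq (hν i hi) x
    have h1 : b.coord i ((T - ν i • 1) w) = 0 := by
      change b.coord i (T w - ν i • w) = 0
      rw [map_sub, hT i hi, map_smul, smul_eq_mul, sub_self]
    rw [hw, map_sub, sub_eq_zero] at h1
    exact h1.symm
  have hsurj : Function.Surjective Φ := by
    intro c
    refine ⟨⟨π (∑ j : S, c j • b j), ⟨_, rfl⟩⟩, funext fun i => ?_⟩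
    rw [hΦ]
    change b.coord i (π (∑ j : S, c j • b j)) = c i
    rw [hcoordπ i i.2, map_sum, Finset.sum_eq_single i]
    · rw [map_smul, coord_basis_self, smul_eq_mul, mul_one]
    · intro j _ hj
      rw [map_smul, coord_basis_of_ne (fun h => hj (Subtype.ext h.symm)), smul_zero]
    · simp
  have hinj : Function.Injective Φ := by
    rw [← LinearMap.ker_eq_bot]
    by_contra hne
    -- The kernel of `Φ` is finite-dimensional and `T`-invariant; if nonzero, it contains an
    -- eigenvector, whose eigenvalue lies in `R`, against `hker`.
    have hinv : ∀ x ∈ π.range, (T : E →ₗ[ℂ] E) x ∈ π.range := by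
      intro x hx
      exact ⟨T x, by rw [ContinuousLinearMap.coe_coe, ContinuousLinearMap.coe_coe, ← hTπ, hππ x hx]⟩
    have hinv2 : ∀ x ∈ LinearMap.ker Φ, (T : E →ₗ[ℂ] E).restrict hinv x ∈ LinearMap.ker Φ := by
      intro x hx
      rw [LinearMap.mem_ker] at hx ⊢
      funext i
      rw [hΦ]
      change b.coord i (T x) = 0
      rw [hT i i.2, ← hΦ, hx]
      simp
    have hnt : Nontrivial (LinearMap.ker Φ) := Submodule.nontrivial_iff_ne_bot.2 hne
    obtain ⟨μ, hμ⟩ := Module.End.exists_eigenvalue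
      (((T : E →ₗ[ℂ] E).restrict hinv).restrict hinv2)
    obtain ⟨x, hx⟩ := hμ.exists_hasEigenvector
    have h1 : T ((x : π.range) : E) = μ • ((x : π.range) : E) :=
      congrArg (fun y : LinearMap.ker Φ => ((y : π.range) : E)) hx.apply_eq_smul
    have hx0 : ((x : π.range) : E) ≠ 0 := fun h0 => hx.2 (Subtype.ext (Subtype.ext h0))
    have hμR : μ ∈ R := h.mem μ (h.mem_list (hππ _ (x : π.range).2) hx0 h1)
    refine hx0 (hker μ hμR _ h1 fun i hi => ?_)
    have h2 : Φ (x : π.range) = 0 := x.2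
    exact (hΦ _ ⟨i, hi⟩).symm.trans (congrFun h2 ⟨i, hi⟩)
  rw [(LinearEquiv.ofBijective Φ ⟨hinj, hsurj⟩).finrank_eq, Module.finrank_fintype_fun_eq_card,
    Fintype.card_coe]

/-- Transfer of the count of eigenvalues from the resolvent to the operator. -/
theorem containsExactly_of_resolvent [CompleteSpace E] {L : E →ₗ.[ℂ] E} {z : ℂ} {T : E →L[ℂ] E}
    (hT : IsResolventAt L z T) (hTc : IsCompactOperator T) {A : Set ℂ} (hz : z ∉ A)
    (hA : IsCompact ((fun w => (w - z)⁻¹) '' A))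
    (hfd : FiniteDimensional ℂ (spectralSubspace T ((fun w => (w - z)⁻¹) '' A))) :
    ContainsExactly L A
      (Module.finrank ℂ (spectralSubspace T ((fun w => (w - z)⁻¹) '' A))) := by
  set g : ℂ → ℂ := fun w => (w - z)⁻¹ with hg
  -- The convention `0⁻¹ = 0` gives `g z = 0`, so `g` is injective on all of `ℂ`.
  have hginj : Function.Injective g := fun u v huv => sub_left_injective (inv_injective huv)
  have hne : ∀ w ∈ A, w ≠ z := fun w hw hwz => hz (hwz ▸ hw)
  have h0 : (0 : ℂ) ∉ g '' A := by
    rintro ⟨w, hw, h⟩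
    exact hne w hw (sub_eq_zero.1 (inv_eq_zero.1 h))
  obtain ⟨l, π, h⟩ := exists_isSpectralProjection_of_isCompact hTc hA h0
  have heig : ∀ w ∈ A, ∀ x : E, T x = g w • x → x ≠ 0 → w ∈ eigenvalues L := by
    intro w hw x hx hx0
    have hwz : w - z ≠ 0 := sub_ne_zero.2 (hne w hw)
    have h1 : x ∈ powKer L w 1 := by
      rw [hT.mem_powKer_iff (hne w hw), pow_one]
      change T x - g w • x = 0
      rw [hx, sub_self]
    rw [mem_powKer_succ] at h1
    obtain ⟨hxD, h1⟩ := h1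
    exact ⟨⟨x, hxD⟩, hx0, sub_eq_zero.1 ((Submodule.mem_bot ℂ).1 h1)⟩
  have heig' : ∀ w ∈ A ∩ eigenvalues L, ∃ x : E, x ≠ 0 ∧ T x = g w • x := by
    rintro w ⟨hw, x, hx0, hx⟩
    refine ⟨x, hx0, ?_⟩
    have h1 : (x : E) ∈ powKer L w 1 := by
      rw [mem_powKer_succ]
      refine ⟨x.2, (Submodule.mem_bot ℂ).2 ?_⟩
      exact sub_eq_zero.2 hx
    rw [hT.mem_powKer_iff (hne w hw), pow_one] at h1
    exact sub_eq_zero.1 h1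
  have hfin : (A ∩ eigenvalues L).Finite := by
    refine Set.Finite.of_finite_image ((List.finite_toSet l).subset ?_) (hginj.injOn (s := _))
    rintro _ ⟨w, hw, rfl⟩
    obtain ⟨x, hx0, hx⟩ := heig' w hw
    exact h.mem_list (h.apply_eq_self (Set.mem_image_of_mem g hw.1) hx) hx0 hx
  have hroot : ∀ w ∈ A, rootSpace L w = Module.End.maxGenEigenspace (T : E →ₗ[ℂ] E) (g w) :=
    fun w hw => hT.rootSpace_eq (hne w hw)
  have hle : ∀ w ∈ A, Module.End.maxGenEigenspace (T : E →ₗ[ℂ] E) (g w) ≤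
      spectralSubspace T (g '' A) :=
    fun w hw => le_iSup₂_of_le (g w) (Set.mem_image_of_mem g hw) le_rfl
  have hmem : ∀ w ∈ hfin.toFinset, w ∈ A := fun w hw => ((Set.Finite.mem_toFinset hfin).1 hw).1
  have hfd' : ∀ w ∈ hfin.toFinset,
      FiniteDimensional ℂ (Module.End.maxGenEigenspace (T : E →ₗ[ℂ] E) (g w)) := fun w hw =>
    Submodule.finiteDimensional_of_le (hle w (hmem w hw))
  refine ⟨hfin, fun w hw => ?_, ?_⟩
  · rw [hroot w (hmem w hw)]
    exact hfd' w hw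
  · rw [Finset.sum_congr rfl fun w hw => by rw [hroot w (hmem w hw)]]
    have hind : iSupIndep fun w => Module.End.maxGenEigenspace (T : E →ₗ[ℂ] E) (g w) :=
      (Module.End.independent_maxGenEigenspace (T : E →ₗ[ℂ] E)).comp hginj
    rw [← (finrank_biSup_of_iSupIndep hind hfin.toFinset hfd').2]
    refine congrArg (fun V : Submodule ℂ E => Module.finrank ℂ V) (le_antisymm ?_ ?_)
    · exact iSup₂_le fun w hw => hle w (hmem w hw)
    · refine iSup₂_le fun μ hμ => ?_
      obtain ⟨w, hw, rfl⟩ := hμ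
      by_cases hwe : w ∈ eigenvalues L
      · exact le_iSup₂_of_le (f := fun w (_ : w ∈ hfin.toFinset) =>
          Module.End.maxGenEigenspace (T : E →ₗ[ℂ] E) (g w)) w
          ((Set.Finite.mem_toFinset hfin).2 ⟨hw, hwe⟩) le_rfl
      · have hbot : Module.End.maxGenEigenspace (T : E →ₗ[ℂ] E) (g w) ≤ ⊥ := by
          intro x hx
          rw [Module.End.mem_maxGenEigenspace] at hx
          obtain ⟨k, hk⟩ := hx
          induction k generalizing x with
          | zero => simpa using hk
          | succ k ih =>
            rw [pow_succ] at hk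
            have h1 : T x - g w • x = 0 := (Submodule.mem_bot ℂ).1 (ih hk)
            by_contra hx0
            exact hwe (heig w hw x (sub_eq_zero.1 h1) hx0)
        exact hbot.trans bot_le

theorem containsExactly_empty (L : E →ₗ.[ℂ] E) : ContainsExactly L ∅ 0 := by
  have h : ((∅ : Set ℂ) ∩ eigenvalues L).Finite := by simp
  exact ⟨h, by simp, by simp⟩

/-- The counting part of the Gershgorin theorem. -/
theorem containsExactly_card [CompleteSpace E]
    (hE : ∀ x : E, ∃ i₀ : ℕ, ∀ i : ℕ, ‖b.coord i x‖ ≤ ‖b.coord i₀ x‖) {L : E →ₗ.[ℂ] E}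
    {l : ℕ → ℕ → ℂ} (hl : IsMatrixOf b L l) (hL : HasCompactResolvent L) {S : Finset ℕ}
    (hS : S.Nonempty)
    (hdisj : Disjoint (⋃ i ∈ S, disk l i) (⋃ i ∈ (S : Set ℕ)ᶜ, disk l i)) :
    ContainsExactly L (⋃ i ∈ S, disk l i) S.card := by
  obtain ⟨C, hC⟩ := exists_norm_coord_le hE
  have hr := radius_ne_top_of_disjoint hS hdisj
  have hR : IsCompact (⋃ i ∈ S, disk l i) := by
    refine S.isCompact_biUnion fun i _ => ?_
    rw [disk_eq_closedBall (hr i)]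
    exact isCompact_closedBall _ _
  obtain ⟨w, T₀, hT₀, hT₀c⟩ := hL
  obtain ⟨U, hU, hRU, hUR⟩ := exists_isolating_nhds hE hl hT₀ hT₀c hr hR hdisj
  have hdiag : ∀ i ∈ S, l i i ∈ ⋃ i ∈ S, disk l i := fun i hi =>
    Set.mem_biUnion hi (diag_mem_disk i)
  have hdisk : ∀ i, i ∉ S → ∀ z ∈ ⋃ i ∈ S, disk l i, z ∉ disk l i := fun i hi z hz hzi =>
    Set.disjoint_left.1 hdisj hz (Set.mem_biUnion (show i ∈ (S : Set ℕ)ᶜ from hi) hzi)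
  generalize (⋃ i ∈ S, disk l i) = R at *
  -- A point of `U \ R` is an eigenvalue of no `L - t A`, so one base point serves all resolvents of
  -- the path. It exists because a nonempty compact subset of `ℂ` is not open.
  obtain ⟨z, hzU, hzR⟩ : ∃ z ∈ U, z ∉ R := by
    by_contra! hsub
    have hUeq : U = R := Set.Subset.antisymm hsub hRU
    have hclopen : IsClopen R := ⟨hR.isClosed, hUeq ▸ hU⟩
    rcases isClopen_iff.1 hclopen with h | h
    · obtain ⟨k, hk⟩ := hS
      have := hdiag k hk
      rw [h] at this
      exact this
    · rw [h] at hR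
      exact noncompact_univ ℂ hR
  set A := rowPart b l S with hA
  have hnoeig : ∀ (t : unitInterval) (x : L.domain),
      L x = z • (x : E) + (((t : ℝ) : ℂ) • A) x → (x : E) = 0 := by
    intro t x hx
    by_contra hx0
    exact hzR (hUR t z hzU x hx hx0)
  obtain ⟨T, hT, hTc⟩ := hT₀.exists_of_notMem_eigenvalues hT₀c (w := z) (by
    rintro ⟨x, hx0, hx⟩
    exact hx0 (hnoeig 0 x (by simp [hx])))
  have hunit : ∀ t : unitInterval, IsUnit (1 - (((t : ℝ) : ℂ) • A) * T) := fun t =>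
    hT.isUnit_one_sub_mul hTc _ (hnoeig t)
  set Tt : unitInterval → E →L[ℂ] E := fun t => perturbedResolvent T (((t : ℝ) : ℂ) • A) with hTt
  have hTtc : ∀ t, IsCompactOperator (Tt t) := fun t => isCompactOperator_mul_right hTc _
  have hcont : Continuous Tt := by
    rw [continuous_iff_continuousAt]
    intro t
    have h1 : ContinuousAt (fun t : unitInterval => (1 - (((t : ℝ) : ℂ) • A) * T)) t := by
      have : Continuous (fun t : unitInterval => (1 - (((t : ℝ) : ℂ) • A) * T)) := by fun_prop
      exact this.continuousAt
    have h2 : ContinuousAt Ring.inverse (1 - (((t : ℝ) : ℂ) • A) * T) := by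
      obtain ⟨u, hu⟩ := hunit t
      rw [← hu]
      exact NormedRing.inverse_continuousAt u
    exact continuousAt_const.mul (ContinuousAt.comp (f := fun t : unitInterval =>
      (1 - (((t : ℝ) : ℂ) • A) * T)) h2 h1)
  have hT0 : Tt 0 = T := by simp [hTt, perturbedResolvent]
  set g : ℂ → ℂ := fun w => (w - z)⁻¹ with hg
  have hgz : ∀ v, z + (g v)⁻¹ = v := fun v => by simp [hg]
  have hR' : IsCompact (g '' R) := by
    refine hR.image_of_continuousOn fun v hv => ?_
    have : v - z ≠ 0 := sub_ne_zero.2 fun h => hzR (h ▸ hv)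
    exact ((continuousAt_id.sub continuousAt_const).inv₀ this).continuousWithinAt
  have h0R' : (0 : ℂ) ∉ g '' R := by
    rintro ⟨v, hv, h⟩
    exact hzR ((sub_eq_zero.1 (inv_eq_zero.1 h)) ▸ hv)
  have hR'mem : ∀ μ, z + μ⁻¹ ∈ R → μ ∈ g '' R := fun μ h => ⟨_, h, by simp [hg]⟩
  have hR'z : ∀ μ ∈ g '' R, μ ≠ 0 ∧ z + μ⁻¹ ∈ R := by
    intro μ hμ
    refine ⟨fun h => h0R' (h ▸ hμ), ?_⟩
    obtain ⟨v, hv, rfl⟩ := hμ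
    rwa [hgz]
  set U' : Set ℂ := {μ | μ ≠ 0 ∧ z + μ⁻¹ ∈ U} with hU'
  have hU'open : IsOpen U' := by
    have h1 : ContinuousOn (fun μ : ℂ => z + μ⁻¹) {0}ᶜ :=
      continuousOn_const.add continuousOn_inv₀
    exact h1.isOpen_inter_preimage isOpen_compl_singleton hU
  have hRU' : g '' R ⊆ U' := fun μ hμ => ⟨(hR'z μ hμ).1, hRU (hR'z μ hμ).2⟩
  have hUR' : ∀ t, ∀ μ ∈ U' \ g '' R, ∀ x, Tt t x = μ • x → x = 0 := by
    rintro t μ ⟨⟨hμ0, hμU⟩, hμR⟩ x hx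
    obtain ⟨hxD, hx'⟩ := hT.eigenvector_of_perturbedResolvent (hunit t) hμ0 hx
    by_contra hx0
    exact hμR (hR'mem μ (hUR t _ hμU ⟨x, hxD⟩ hx' hx0))
  have hpath := finrank_spectralSubspace_path hcont hTtc hR' h0R' hU'open hRU' hUR' 0 1
  have hdata : ∀ t, ∃ l' π, IsSpectralProjection (Tt t) (g '' R) l' π ∧
      FiniteDimensional ℂ (spectralSubspace (Tt t) (g '' R)) ∧
        Module.finrank ℂ (spectralSubspace (Tt t) (g '' R)) = Module.finrank ℂ π.range := by
    intro t
    obtain ⟨l', π, h⟩ := exists_isSpectralProjection_of_isCompact (hTtc t) hR' h0R'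
    exact ⟨l', π, h, (h.eventually_finrank_eq hR' hU'open hRU').self_of_nhds (hUR' t)⟩
  -- For `L - A` the coordinates in `S` are eigenfunctionals. An eigenvector on which they all
  -- vanish has its maximal coordinate outside `S`, hence its eigenvalue in a disk disjoint from
  -- `R`.
  have hone : Module.finrank ℂ (spectralSubspace (Tt 1) (g '' R)) = S.card := by
    obtain ⟨l', π, h, -, hfr⟩ := hdata 1
    rw [hfr]
    refine h.finrank_range_eq_card (b := b) (S := S) (ν := fun i => g (l i i))
      (fun i hi => Set.mem_image_of_mem g (hdiag i hi)) ?_ ?_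
    · intro i hi y
      have hne : l i i - z ≠ 0 := sub_ne_zero.2 fun h => hzR (h ▸ hdiag i hi)
      have h1 := hT.apply_perturbedResolvent (hunit 1) y
      have h2 := hl.coord_apply hC (hr i) ⟨Tt 1 y, hT.perturbedResolvent_mem _ y⟩
      have h3 : b.coord i (z • Tt 1 y + (((1 : unitInterval) : ℝ) : ℂ) • A (Tt 1 y) + y) =
          l i i * b.coord i (Tt 1 y) + rowFunctional b l i (Tt 1 y) := by
        rw [← h2]; exact congrArg (b.coord i) h1.symm
      simp only [map_add, map_smul, hA, coord_rowPart, if_pos hi, smul_eq_mul,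
        Set.Icc.coe_one, Complex.ofReal_one, one_mul] at h3
      change b.coord i (Tt 1 y) = (l i i - z)⁻¹ * b.coord i y
      rw [eq_inv_mul_iff_mul_eq₀ hne]
      linear_combination -h3
    · intro μ hμ x hx hxS
      obtain ⟨hμ0, hμR⟩ := hR'z μ hμ
      obtain ⟨hxD, hx'⟩ := hT.eigenvector_of_perturbedResolvent (hunit 1) hμ0 hx
      by_contra hx0
      obtain ⟨i, hi⟩ := hE x
      have hzi := mem_disk_of_damped hC hl S 1 (x := ⟨x, hxD⟩) hx0 hx' hi
      refine hdisk i (fun hiS => hx0 (eq_zero_of_coord_eq_zero (b := b) fun j => ?_)) _ hμR hzi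
      have h1 := hi j
      rw [hxS i hiS, norm_zero] at h1
      exact norm_le_zero_iff.1 h1
  obtain ⟨-, -, -, hfd, -⟩ := hdata 0
  rw [hone, hT0] at hpath
  rw [hT0] at hfd
  rw [← hpath]
  exact containsExactly_of_resolvent hT hTc hzR hR' hfd

end Count

end InfiniteGershgorin

theorem mainTheorem4 {E : Type*} [NormedAddCommGroup E] [NormedSpace ℂ E] [CompleteSpace E]
    (b : SchauderBasis ℂ E)
    (hE : ∀ x : E, ∃ i₀ : ℕ, ∀ i : ℕ, ‖b.coord i x‖ ≤ ‖b.coord i₀ x‖)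
    (L : E →ₗ.[ℂ] E) (l : ℕ → ℕ → ℂ)
    (hl : InfiniteGershgorin.IsMatrixOf b L l)
    (hL : InfiniteGershgorin.HasCompactResolvent L) :
    (InfiniteGershgorin.spectrum L ⊆ ⋃ i : ℕ, InfiniteGershgorin.disk l i) ∧
      ∀ S : Finset ℕ,
        Disjoint (⋃ i ∈ S, InfiniteGershgorin.disk l i)
            (⋃ i ∈ (S : Set ℕ)ᶜ, InfiniteGershgorin.disk l i) →
          InfiniteGershgorin.ContainsExactly L (⋃ i ∈ S, InfiniteGershgorin.disk l i) S.card := by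
  constructor
  · intro z hz
    by_contra hz'
    obtain ⟨w, T, hT, hTc⟩ := hL
    obtain ⟨T', hT', -⟩ := hT.exists_of_notMem_eigenvalues hTc (w := z) fun h =>
      hz' (InfiniteGershgorin.eigenvalues_subset_iUnion_disk hE hl h)
    exact hz ⟨T', hT'⟩
  · intro S hdisj
    -- For empty `S` disjointness is vacuous and does not exclude infinite radii, so this case is
    -- separate.
    rcases S.eq_empty_or_nonempty with rfl | hS
    · simpa using InfiniteGershgorin.containsExactly_empty L
    · exact InfiniteGershgorin.containsExactly_card hE hl hL hS hdisj
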